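/- Let $\Omega\subset\mathbb R^d$ be a bounded open set, $f\in L^\infty(\Omega)$, $\alpha_+,\alpha_->0$ constants, and $A\in L^\infty(\Omega,\mathbb R^{d\times d})$ symmetric with $A(x)\xi\cdot\xi\ge c_1|\xi|^2$ for a.e. $x\in\Omega$ and all $\xi\in\mathbb R^d$, for some $c_1>0$. Let $V_0=H^1_0(\Omega)$, $u_D\in H^1(\Omega)$, and $$J(v)=\int_\Omega\Big(\tfrac12A\nabla v\cdot\nabla v-fv+\alpha_+v_++\alpha_-v_-\Big)dx ,\qquad v_+=\max(v,0),\quad v_-=\max(-v,0).$$ Let $u$ be the minimizer of $J$ on $V_0+u_D$ and $p^*=A\nabla u$. Put $\|y\|_B^2=\int_\Omega By\cdot y\,dx$ for a matrix function $B$, and, for $y\in L^2(\Omega,\mathbb R^d)$ and $w\in V_0$, $$\widehat G(y)=\tfrac12\int_\Omega A(y+\nabla u_D)\cdot(y+\nabla u_D)\,dx,\qquad \widehat F(w)=\int_\Omega\big(-f(w+u_D)+\alpha_+(w+u_D)_++\alpha_-(w+u_D)_-\big)dx.$$ Let $\widehat G^*$, $\widehat F^*$ be their Young–Fenchel conjugates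 on $L^2(\Omega,\mathbb R^d)$ and $V_0$, let $\langle-\Lambda^*y^*,w\rangle=-\int_\Omega y^*\cdot\nabla w\,dx$, and put $$\widehat I^*(y^*)=-\widehat G^*(y^*)-\widehat F^*(-\Lambda^*y^*),\qquad D_{\widehat F}(w,w^*)=\widehat F(w)+\widehat F^*(w^*)-\langle w^*,w\rangle,$$ $$D_{\widehat G}(y,y^*)=\widehat G(y)+\widehat G^*(y^*)-\int_\Omega y^*\cdot y\,dx .$$ Let $v\in V_0+u_D$, and let $y^*\in L^2(\Omega,\mathbb R^d)$ have a weak divergence in $L^2(\Omega)$ with $\operatorname{div}y^*+f\in[-\alpha_-,\alpha_+]$ a.e. in $\Omega$. Define $$\mu_\omega(v)=D_{\widehat F}(v-u_D,-\Lambda^*p^*),\qquad \mu^*_\omega(y^*)=D_{\widehat F}(u-u_D,-\Lambda^*y^*).$$ Then $$\mathbb M(u,v):=\tfrac12\|\nabla(u-v)\|_A^2+\mu_\omega(v)=J(v)-J(u),$$ $$\mathbb M(p^*,y^*):=\tfrac12\|p^*-y^*\|_{A^{-1}}^2+\mu^*_\omega(y^*)=\widehat I^*(p^*)-\widehat I^*(y^*),$$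 and the quantity $$\mathbb M(\{u,p^*\},\{v,y^*\}):=D_{\widehat F}(u-u_D,-\Lambda^*y^*)+D_{\widehat F}(v-u_D,-\Lambda^*p^*)+D_{\widehat G}(\nabla(u-u_D),y^*)+D_{\widehat G}(\nabla(v-u_D),p^*)$$ satisfies $$\mathbb M(\{u,p^*\},\{v,y^*\})=\mathbb M(u,v)+\mathbb M(p^*,y^*)=\tfrac12\|A\nabla v-y^*\|_{A^{-1}}^2+\Upsilon(v,y^*),$$ where $$\Upsilon(v,y^*)=\int_\Omega\big(\alpha_+v_++\alpha_-v_--(f+\operatorname{div}y^*)v\big)dx\ \ge\ 0$$ vanishes if $v=u$ and $y^*=p^*$. Moreover, $p^*$ has a weak divergence in $L^2(\Omega)$ with $\operatorname{div}p^*+f\in[-\alpha_-,\alpha_+]$ a.e., equal to $\alpha_+$ a.e. on $\{u>0\}$ and to $-\alpha_-$ a.e. on $\{u<0\}$. For $y\in\{y^*,p^*\}$, $\widehat I^*(y)$ is finite and equals $-\tfrac12\|y\|^2_{A^{-1}}+\int_\Omega(y\cdot\nabla u_D+u_D\operatorname{div}y)\,dx$. The nonlinear measures have the form $$\mu_\omega(v)=\int_{\{v>0\}}(\alpha_+-(\operatorname{div}p^*+f))\,v\,dx+\int_{\{v<0\}}(-\alpha_--(\operatorname{div}p^*+f))\,v\,dx,$$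 $$\mu^*_\omega(y^*)=\int_{\{u>0\}}(\alpha_+-(\operatorname{div}y^*+f))\,u\,dx+\int_{\{u<0\}}(-\alpha_--(\operatorname{div}y^*+f))\,u\,dx .$$ If in addition $\operatorname{div}p^*+f=0$ a.e. on $\{u=0\}$, then $\mu_\omega(v)=\int_\Omega\alpha(x)|v|\,dx$, where $\alpha=\alpha_+$ on $\{v>0,\,u=0\}$, $\alpha=\alpha_-$ on $\{v<0,\,u=0\}$, $\alpha=\alpha_++\alpha_-$ on $\{v>0,\,u<0\}\cup\{v<0,\,u>0\}$, and $\alpha=0$ elsewhere. -/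

import Mathlib

open MeasureTheory TopologicalSpace
open scoped ENNReal RealInnerProductSpace

noncomputable section

/-- The Euclidean space `ℝ^d`. -/
abbrev Euc (d : ℕ) : Type := EuclideanSpace ℝ (Fin d)

/-- Lebesgue measure on `Ω`. -/
abbrev leb {d : ℕ} (Ω : Opens (Euc d)) : Measure (Euc d) :=
  volume.restrict (Ω : Set (Euc d))

/-- `L²(Ω)`. -/
abbrev L2 {d : ℕ} (Ω : Opens (Euc d)) : Type := Lp ℝ 2 (leb Ω)

/-- `L²(Ω, ℝ^d)`. -/
abbrev L2Vec {d : ℕ} (Ω : Opens (Euc d)) : Type := Lp (Euc d) 2 (leb Ω)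

/-- The space `L²(Ω) × L²(Ω, ℝ^d)`. A Sobolev function `v ∈ H¹(Ω)` is represented in it by the
pair `(v, ∇v)`; so `w.1` is the function and `w.2` is its weak gradient, for `w` in `H1 Ω`. -/
abbrev FunGrad {d : ℕ} (Ω : Opens (Euc d)) : Type := L2 Ω × L2Vec Ω

/-- `H¹(Ω)`: pairs `(v, g)` of square integrable functions such that `g` is the weak gradient
of `v`, i.e. `∫ v ∇φ = - ∫ φ g` for all `φ ∈ C_c^∞(Ω)`. -/
def H1 {d : ℕ} (Ω : Opens (Euc d)) : Set (FunGrad Ω) :=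
  {w | ∀ φ : TestFunction Ω ℝ ⊤,
    ∫ x, w.1 x • gradient φ x ∂(leb Ω) = - ∫ x, φ x • w.2 x ∂(leb Ω)}

/-- `V₀ = H¹₀(Ω)`: the closure of `C_c^∞(Ω)` in the norm of `H¹(Ω)`. -/
def H10 {d : ℕ} (Ω : Opens (Euc d)) : Set (FunGrad Ω) :=
  closure {w | ∃ φ : TestFunction Ω ℝ ⊤, w.1 =ᵐ[leb Ω] φ ∧ w.2 =ᵐ[leb Ω] gradient φ}

/-- `q` is the weak divergence of the vector field `y` in `Ω`. -/
def IsWeakDiv {d : ℕ} (Ω : Opens (Euc d)) (y : Euc d → Euc d) (q : Euc d → ℝ) : Prop :=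
  ∀ φ : TestFunction Ω ℝ ⊤,
    ∫ x, ⟪y x, gradient φ x⟫ ∂(leb Ω) = - ∫ x, q x * φ x ∂(leb Ω)

/-- The matrix-vector product on Euclidean space. -/
def matApply {d : ℕ} (M : Matrix (Fin d) (Fin d) ℝ) (ξ : Euc d) : Euc d :=
  WithLp.toLp 2 (M.mulVec ξ.ofLp)

/-- `‖y‖²_B = ∫_Ω B y · y`. -/
def weightedNormSq {d : ℕ} (Ω : Opens (Euc d)) (B : Euc d → Matrix (Fin d) (Fin d) ℝ)
    (y : Euc d → Euc d) : ℝ :=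
  ∫ x, ⟪matApply (B x) (y x), y x⟫ ∂(leb Ω)

/-- The weight `α(x)`, as a function of the values `a = u(x)` and `b = v(x)`. It equals `α₊` on
`ω₊ = {v > 0, u = 0}`, `α₋` on `ω₋ = {v < 0, u = 0}`, `α₊ + α₋` where `u` and `v` have opposite
(nonzero) signs, and `0` elsewhere. -/
def phaseWeight (αp αm a b : ℝ) : ℝ :=
  if 0 < b ∧ a = 0 then αp
  else if b < 0 ∧ a = 0 then αm
  else if (0 < b ∧ a < 0) ∨ (b < 0 ∧ 0 < a) then αp + αm
  else 0

/-- The data of the two-phase (double) obstacle problem in `Ω`, with the standing assumptions on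
them. The pair `uD` stands for `(u_D, ∇u_D)`. -/
structure TwoPhaseProblem {d : ℕ} (Ω : Opens (Euc d)) where
  A : Euc d → Matrix (Fin d) (Fin d) ℝ
  f : Euc d → ℝ
  αp : ℝ
  αm : ℝ
  uD : FunGrad Ω
  A_bounded : ∀ i j, MemLp (fun x => A x i j) ∞ (leb Ω)
  A_symm : ∀ᵐ x ∂(leb Ω), (A x).IsSymm
  A_coercive : ∃ c : ℝ, 0 < c ∧ ∀ᵐ x ∂(leb Ω), ∀ ξ : Euc d, c * ‖ξ‖ ^ 2 ≤ ⟪matApply (A x) ξ, ξ⟫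
  f_bounded : MemLp f ∞ (leb Ω)
  αp_pos : 0 < αp
  αm_pos : 0 < αm
  uD_mem : uD ∈ H1 Ω

namespace TwoPhaseProblem

variable {d : ℕ} {Ω : Opens (Euc d)} (P : TwoPhaseProblem Ω)

/-- The affine space `V₀ + u_D`. -/
def affineSpace : Set (FunGrad Ω) := {v | v - P.uD ∈ H10 Ω}

/-- The energy `J(v) = ∫ (½ A∇v·∇v - f v + α₊ v₊ + α₋ v₋)`. -/
def J (v : FunGrad Ω) : ℝ :=
  ∫ x, (1 / 2 * ⟪matApply (P.A x) (v.2 x), v.2 x⟫ - P.f x * v.1 x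
    + P.αp * (v.1 x)⁺ + P.αm * (v.1 x)⁻) ∂(leb Ω)

/-- `u` is a minimizer of `J` on `V₀ + u_D`. -/
def IsMinimizer (u : FunGrad Ω) : Prop :=
  u ∈ P.affineSpace ∧ ∀ w ∈ P.affineSpace, P.J u ≤ P.J w

/-- The flux `A∇u`. -/
def flux (u : FunGrad Ω) : Euc d → Euc d := fun x => matApply (P.A x) (u.2 x)

/-- `y ∈ L²(Ω, ℝ^d)` has the weak divergence `q ∈ L²(Ω)`, and `q + f ∈ [-α₋, α₊]` a.e. -/
def IsAdmissibleFlux (y : Euc d → Euc d) (q : Euc d → ℝ) : Prop :=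
  MemLp y 2 (leb Ω) ∧ MemLp q 2 (leb Ω) ∧ IsWeakDiv Ω y q ∧
    ∀ᵐ x ∂(leb Ω), q x + P.f x ∈ Set.Icc (-P.αm) P.αp

/-- `Ĝ(y) = ½ ∫ A(y + ∇u_D)·(y + ∇u_D)`. -/
def Ghat (y : Euc d → Euc d) : ℝ :=
  1 / 2 * weightedNormSq Ω P.A (fun x => y x + P.uD.2 x)

/-- `F̂(w) = ∫ (- f (w + u_D) + α₊ (w + u_D)₊ + α₋ (w + u_D)₋)`. -/
def Fhat (w : FunGrad Ω) : ℝ :=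
  ∫ x, (- P.f x * (w.1 x + P.uD.1 x) + P.αp * (w.1 x + P.uD.1 x)⁺
    + P.αm * (w.1 x + P.uD.1 x)⁻) ∂(leb Ω)

/-- The Young-Fenchel conjugate of `Ĝ` on `L²(Ω, ℝ^d)`. -/
def GhatStar (ystar : Euc d → Euc d) : EReal :=
  ⨆ y : L2Vec Ω, ((∫ x, ⟪ystar x, y x⟫ ∂(leb Ω) - P.Ghat y : ℝ) : EReal)

/-- The Young-Fenchel conjugate of `F̂` on `V₀`, evaluated at a functional `ℓ`. -/
def FhatStar (ℓ : FunGrad Ω → ℝ) : EReal :=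
  ⨆ w ∈ H10 Ω, ((ℓ w - P.Fhat w : ℝ) : EReal)

/-- The functional `-Λ*y*` on `V₀`, where `Λ = ∇`: `w ↦ - ∫ y*·∇w`. -/
def negAdjGrad (ystar : Euc d → Euc d) (w : FunGrad Ω) : ℝ :=
  - ∫ x, ⟪ystar x, w.2 x⟫ ∂(leb Ω)

/-- The dual energy `Î*(y*) = - Ĝ*(y*) - F̂*(-Λ*y*)`. -/
def Istar (ystar : Euc d → Euc d) : EReal :=
  - P.GhatStar ystar - P.FhatStar (negAdjGrad ystar)

/-- The compound functional of `F̂`. -/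
def DF (w : FunGrad Ω) (ℓ : FunGrad Ω → ℝ) : EReal :=
  (P.Fhat w : EReal) + P.FhatStar ℓ - (ℓ w : EReal)

/-- The compound functional of `Ĝ`. -/
def DG (y ystar : Euc d → Euc d) : EReal :=
  (P.Ghat y : EReal) + P.GhatStar ystar - ((∫ x, ⟪ystar x, y x⟫ ∂(leb Ω) : ℝ) : EReal)

/-- The measure `μ_ω(v) = D_F̂(v - u_D, -Λ*p*)` with `p* = A∇u`. -/
def mu (u v : FunGrad Ω) : EReal := P.DF (v - P.uD) (negAdjGrad (P.flux u))

/-- The measure `μ*_ω(y*) = D_F̂(u - u_D, -Λ*y*)`. -/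
def muStar (u : FunGrad Ω) (ystar : Euc d → Euc d) : EReal :=
  P.DF (u - P.uD) (negAdjGrad ystar)

/-- The primal error measure `½ ‖∇(u - v)‖²_A + μ_ω(v)`. -/
def errPrimal (u v : FunGrad Ω) : EReal :=
  ((1 / 2 * weightedNormSq Ω P.A (fun x => u.2 x - v.2 x) : ℝ) : EReal) + P.mu u v

/-- The dual error measure `½ ‖p* - y*‖²_{A⁻¹} + μ*_ω(y*)` with `p* = A∇u`. -/
def errDual (u : FunGrad Ω) (ystar : Euc d → Euc d) : EReal :=
  ((1 / 2 * weightedNormSq Ω (fun x => (P.A x)⁻¹) (fun x => P.flux u x - ystar x) : ℝ) : EReal)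
    + P.muStar u ystar

/-- The error measure of the pair `(v, y*)` with respect to `(u, p*)`, `p* = A∇u`: the sum of
the four compound functionals. -/
def errPair (u v : FunGrad Ω) (ystar : Euc d → Euc d) : EReal :=
  P.DF (u - P.uD) (negAdjGrad ystar) + P.DF (v - P.uD) (negAdjGrad (P.flux u))
    + P.DG ((u - P.uD).2 : L2Vec Ω) ystar + P.DG ((v - P.uD).2 : L2Vec Ω) (P.flux u)

/-- `Υ(v, y*) = ∫ (α₊ v₊ + α₋ v₋ - (f + div y*) v)`, where `q = div y*`. -/
def Upsilon (v : FunGrad Ω) (q : Euc d → ℝ) : ℝ :=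
  ∫ x, (P.αp * (v.1 x)⁺ + P.αm * (v.1 x)⁻ - (P.f x + q x) * v.1 x) ∂(leb Ω)

end TwoPhaseProblem

end

/-! ### Pairs (function, weak gradient), integration by parts and density in `L²(Ω)` -/

section SobolevPairs

variable {d : ℕ} {Ω : Opens (Euc d)}

/-! Both compound functionals have a closed form, finite on admissible fluxes, so all identities
become real arithmetic. Completing the square gives `Ĝ*`, hence `D_Ĝ(∇(v - u_D), y) = ½‖A∇v -
y‖²_{A⁻¹}` (`GhatStar_eq`, `DG_eq`). For admissible `y` with divergence `q`, integration by parts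
turns `⟨-Λ*y, w⟩ - F̂(w)` into `-∫ q u_D - Υ(w + u_D, q)`. Here `Υ ≥ 0`, because `[-α₋, α₊]` is the
subdifferential at `0` of `t ↦ α₊t₊ + α₋t₋`. Its infimum over `V₀ + u_D` is `0`, because `V₀` is
dense in `L²(Ω)` and `Υ` is controlled by the `L¹` norm. Hence `D_F̂(v - u_D, -Λ*y) = Υ(v, q)`
(`FhatStar_eq`, `DF_eq`).

The analytic core is the regularity of `p* = A∇u`. Minimality gives `∫ (f w - p*·∇w) ≤ S(w)` on
`V₀`, where `S` is the one-sided derivative at `u` of the phase term. As `S` is sublinear and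
bounded on `L²(Ω)`, Hahn–Banach and Riesz represent the residual by some `h ∈ L²(Ω)` with `∫ h z ≤
S(z)` for every `z`. Localizing this inequality yields `h ∈ [-α₋, α₊]` with equality at the proper
endpoint where `u ≠ 0`. So `div p* = h - f`, and `Υ(u, div p*) = 0`. The identities then follow by
expanding squares and integrating by parts on `V₀ + u_D`. -/

lemma gradient_eq_toDual_symm_comp_fderiv (φ : Euc d → ℝ) :
    gradient φ = fun x => (InnerProductSpace.toDual ℝ (Euc d)).symm (fderiv ℝ φ x) := rfl

lemma TestFunction.differentiable (φ : TestFunction Ω ℝ ⊤) : Differentiable ℝ φ :=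
  φ.contDiff.differentiable (by simp)

lemma TestFunction.memLp (φ : TestFunction Ω ℝ ⊤) : MemLp φ 2 (leb Ω) :=
  φ.continuous.memLp_of_hasCompactSupport φ.hasCompactSupport

lemma TestFunction.memLp_gradient (φ : TestFunction Ω ℝ ⊤) : MemLp (gradient φ) 2 (leb Ω) := by
  rw [gradient_eq_toDual_symm_comp_fderiv]
  refine Continuous.memLp_of_hasCompactSupport ?_ ?_
  · exact (LinearIsometryEquiv.continuous _).comp (φ.contDiff.continuous_fderiv (by simp))
  · exact (φ.hasCompactSupport.fderiv ℝ).comp_left (map_zero _)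

lemma TestFunction.gradient_add (φ ψ : TestFunction Ω ℝ ⊤) (x : Euc d) :
    gradient (φ + ψ : TestFunction Ω ℝ ⊤) x = gradient φ x + gradient ψ x := by
  have h : ((φ + ψ : TestFunction Ω ℝ ⊤) : Euc d → ℝ) = fun x => φ x + ψ x := by ext; simp
  simp only [gradient_eq_toDual_symm_comp_fderiv, h]
  rw [fderiv_fun_add (φ.differentiable x) (ψ.differentiable x), map_add]

lemma TestFunction.gradient_smul (c : ℝ) (φ : TestFunction Ω ℝ ⊤) (x : Euc d) :
    gradient (c • φ : TestFunction Ω ℝ ⊤) x = c • gradient φ x := by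
  have h : ((c • φ : TestFunction Ω ℝ ⊤) : Euc d → ℝ) = fun x => c • φ x := by ext; simp
  simp only [gradient_eq_toDual_symm_comp_fderiv, h]
  rw [fderiv_fun_const_smul (φ.differentiable x), map_smul]

variable (Ω) in
/-- The test functions, as a subspace of `L²(Ω) × L²(Ω, ℝ^d)`. -/
noncomputable def testPairs : Submodule ℝ (FunGrad Ω) where
  carrier := {w | ∃ φ : TestFunction Ω ℝ ⊤, w.1 =ᵐ[leb Ω] φ ∧ w.2 =ᵐ[leb Ω] gradient φ}
  zero_mem' := by
    refine ⟨0, ?_, ?_⟩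
    · filter_upwards [Lp.coeFn_zero ℝ 2 (leb Ω)] with x hx
      simpa using hx
    · filter_upwards [Lp.coeFn_zero (Euc d) 2 (leb Ω)] with x hx
      have := TestFunction.gradient_smul (0 : ℝ) (0 : TestFunction Ω ℝ ⊤) x
      rw [zero_smul, zero_smul] at this
      rw [this]
      simpa using hx
  add_mem' := by
    rintro a b ⟨φ, h1, h2⟩ ⟨ψ, h3, h4⟩
    refine ⟨φ + ψ, ?_, ?_⟩
    · filter_upwards [Lp.coeFn_add a.1 b.1, h1, h3] with x hx e1 e3
      rw [Prod.fst_add, hx, Pi.add_apply, e1, e3]; rfl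
    · filter_upwards [Lp.coeFn_add a.2 b.2, h2, h4] with x hx e1 e3
      rw [TestFunction.gradient_add, Prod.snd_add, hx, Pi.add_apply, e1, e3]
  smul_mem' := by
    rintro c a ⟨φ, h1, h2⟩
    refine ⟨c • φ, ?_, ?_⟩
    · filter_upwards [Lp.coeFn_smul c a.1, h1] with x hx e1
      simp [hx, e1]
    · filter_upwards [Lp.coeFn_smul c a.2, h2] with x hx e1
      rw [TestFunction.gradient_smul, Prod.smul_snd, hx, Pi.smul_apply, e1]

variable (Ω) in
/-- `H¹₀(Ω)` as a closed subspace. -/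
noncomputable def sobolevZero : Submodule ℝ (FunGrad Ω) := (testPairs Ω).topologicalClosure

lemma mem_sobolevZero {w : FunGrad Ω} : w ∈ sobolevZero Ω ↔ w ∈ H10 Ω := Iff.rfl

lemma integral_inner_toLp {E : Type*} [NormedAddCommGroup E] [InnerProductSpace ℝ E]
    {μ : Measure (Euc d)} {y : Euc d → E} (hy : MemLp y 2 μ) (z : Lp E 2 μ) :
    ⟪hy.toLp y, z⟫ = ∫ x, ⟪y x, z x⟫ ∂μ := by
  rw [L2.inner_def]
  refine integral_congr_ae ?_
  filter_upwards [hy.coeFn_toLp] with x hx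
  rw [hx]

lemma integral_mul_toLp {μ : Measure (Euc d)} {q : Euc d → ℝ} (hq : MemLp q 2 μ)
    (z : Lp ℝ 2 μ) : ⟪hq.toLp q, z⟫ = ∫ x, q x * z x ∂μ := by
  rw [integral_inner_toLp]
  simp [mul_comm]

/-- A test function, as an element of `H¹₀(Ω)`. -/
noncomputable def TestFunction.toPair (φ : TestFunction Ω ℝ ⊤) : FunGrad Ω :=
  (φ.memLp.toLp φ, φ.memLp_gradient.toLp _)

lemma TestFunction.toPair_mem (φ : TestFunction Ω ℝ ⊤) : φ.toPair ∈ testPairs Ω :=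
  ⟨φ, φ.memLp.coeFn_toLp, φ.memLp_gradient.coeFn_toLp⟩

/-- The formula of integration by parts for functions in `H¹₀(Ω)`. -/
lemma IsWeakDiv.integral_inner_eq {y : Euc d → Euc d} {q : Euc d → ℝ} (h : IsWeakDiv Ω y q)
    (hy : MemLp y 2 (leb Ω)) (hq : MemLp q 2 (leb Ω)) {w : FunGrad Ω} (hw : w ∈ H10 Ω) :
    ∫ x, ⟪y x, w.2 x⟫ ∂(leb Ω) = - ∫ x, q x * w.1 x ∂(leb Ω) := by
  rw [← integral_inner_toLp hy, ← integral_mul_toLp hq]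
  -- Both sides are continuous in the norm of `L² × L²`, so the identity passes from test functions
  -- to their closure.
  have hc : IsClosed {w : FunGrad Ω | ⟪hy.toLp y, w.2⟫ = -⟪hq.toLp q, w.1⟫} :=
    isClosed_eq (by fun_prop) (by fun_prop)
  refine closure_minimal ?_ hc hw
  rintro w ⟨φ, h1, h2⟩
  rw [Set.mem_ofPred_eq, integral_inner_toLp hy, integral_mul_toLp hq]
  calc ∫ x, ⟪y x, w.2 x⟫ ∂(leb Ω) = ∫ x, ⟪y x, gradient φ x⟫ ∂(leb Ω) :=
        integral_congr_ae (by filter_upwards [h2] with x hx; rw [hx])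
    _ = - ∫ x, q x * φ x ∂(leb Ω) := h φ
    _ = _ := by
        congr 1
        exact integral_congr_ae (by filter_upwards [h1] with x hx; rw [hx])

lemma isWeakDiv_of_forall_H10 {y : Euc d → Euc d} {q : Euc d → ℝ}
    (h : ∀ w ∈ H10 Ω, ∫ x, ⟪y x, w.2 x⟫ ∂(leb Ω) = - ∫ x, q x * w.1 x ∂(leb Ω)) :
    IsWeakDiv Ω y q := by
  intro φ
  have := h φ.toPair (subset_closure φ.toPair_mem)
  calc _ = ∫ x, ⟪y x, φ.toPair.2 x⟫ ∂(leb Ω) := integral_congr_ae (by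
        filter_upwards [φ.memLp_gradient.coeFn_toLp] with x hx; rw [TestFunction.toPair, hx])
    _ = _ := this
    _ = _ := by
        congr 1
        exact integral_congr_ae (by
          filter_upwards [φ.memLp.coeFn_toLp] with x hx; rw [TestFunction.toPair, hx])

/-- A square integrable function which is orthogonal to all test functions vanishes. -/
lemma ae_eq_zero_of_forall_testFunction {h : Euc d → ℝ} (hh : MemLp h 2 (leb Ω))
    (H : ∀ φ : TestFunction Ω ℝ ⊤, ∫ x, φ x * h x ∂(leb Ω) = 0) : h =ᵐ[leb Ω] 0 := by
  have hli : LocallyIntegrable h (leb Ω) := hh.locallyIntegrable (by norm_num)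
  have hΩ := Ω.isOpen.measurableSet
  have key : ∀ᵐ x ∂(volume : Measure (Euc d)), x ∈ (Ω : Set (Euc d)) → h x = 0 := by
    refine Ω.isOpen.ae_eq_zero_of_integral_contDiff_smul_eq_zero ?_ ?_
    · rw [locallyIntegrableOn_iff Ω.isOpen.isLocallyClosed]
      intro K hK hKc
      have := hli.integrableOn_isCompact hKc
      rwa [IntegrableOn, Measure.restrict_restrict hKc.measurableSet,
        Set.inter_eq_left.2 hK] at this
    · intro g hg hgc hgs
      have := H ⟨g, hg, hgc, hgs⟩
      rw [← this, eq_comm]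
      refine setIntegral_eq_integral_of_forall_compl_eq_zero fun x hx => ?_
      have : g x = 0 := image_eq_zero_of_notMem_tsupport fun h => hx (hgs h)
      change g x * h x = 0
      simp [this]
  exact (ae_restrict_iff' hΩ).2 key

/-- The functions in `H¹₀(Ω)` are dense in `L²(Ω)`. -/
lemma exists_mem_H10_norm_sub_lt (g : L2 Ω) {ε : ℝ} (hε : 0 < ε) :
    ∃ w ∈ H10 Ω, ‖g - w.1‖ < ε := by
  let K : Submodule ℝ (L2 Ω) := (testPairs Ω).map (LinearMap.fst ℝ (L2 Ω) (L2Vec Ω))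
  have hK : K.topologicalClosure = ⊤ := by
    -- Density in a Hilbert space: only `0` is orthogonal to all test functions.
    rw [Submodule.topologicalClosure_eq_top_iff, Submodule.eq_bot_iff]
    intro h hh
    rw [Submodule.mem_orthogonal] at hh
    refine (Lp.eq_zero_iff_ae_eq_zero).2 (ae_eq_zero_of_forall_testFunction (Lp.memLp h) ?_)
    intro φ
    rw [← integral_mul_toLp φ.memLp]
    exact hh _ ⟨φ.toPair, φ.toPair_mem, rfl⟩
  have hg : g ∈ closure (K : Set (L2 Ω)) := by
    change g ∈ K.topologicalClosure
    rw [hK]; trivial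
  obtain ⟨_, ⟨w, hw, rfl⟩, hlt⟩ := Metric.mem_closure_iff.1 hg ε hε
  exact ⟨w, subset_closure hw, by rwa [dist_eq_norm] at hlt⟩

/-- Uniqueness of the divergence; it makes `Υ(v, y*)` vanish when `y*` agrees with `p*` almost
everywhere. -/
lemma IsWeakDiv.ae_eq {y z : Euc d → Euc d} {q r : Euc d → ℝ} (h : IsWeakDiv Ω y q)
    (h' : IsWeakDiv Ω z r) (hq : MemLp q 2 (leb Ω)) (hr : MemLp r 2 (leb Ω))
    (hyz : y =ᵐ[leb Ω] z) : q =ᵐ[leb Ω] r := by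
  have := ae_eq_zero_of_forall_testFunction (hq.sub hr) fun φ => by
    have e : ∫ x, ⟪y x, gradient φ x⟫ ∂(leb Ω) = ∫ x, ⟪z x, gradient φ x⟫ ∂(leb Ω) :=
      integral_congr_ae (by filter_upwards [hyz] with x hx; rw [hx])
    rw [h φ, h' φ] at e
    have i1 := hq.integrable_mul φ.memLp
    have i2 := hr.integrable_mul φ.memLp
    calc _ = ∫ x, (q x * φ x - r x * φ x) ∂(leb Ω) :=
          integral_congr_ae (.of_forall fun x => by simp; ring)
      _ = ∫ x, q x * φ x ∂(leb Ω) - ∫ x, r x * φ x ∂(leb Ω) := integral_sub i1 i2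
      _ = 0 := by linarith
  filter_upwards [this] with x hx
  simpa [sub_eq_zero] using hx

end SobolevPairs

/-! ### Coercive symmetric matrices and their inverses -/

section MatrixApply

variable {d : ℕ} (M : Matrix (Fin d) (Fin d) ℝ)

lemma matApply_add (ξ η : Euc d) : matApply M (ξ + η) = matApply M ξ + matApply M η := by
  ext i; simp [matApply, Matrix.mulVec_add]

lemma matApply_smul (c : ℝ) (ξ : Euc d) : matApply M (c • ξ) = c • matApply M ξ := by
  ext i; simp [matApply, Matrix.mulVec_smul]

lemma matApply_sub (ξ η : Euc d) : matApply M (ξ - η) = matApply M ξ - matApply M η := by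
  ext i; simp [matApply, Matrix.mulVec_sub]

lemma matApply_eq_sum (ξ : Euc d) :
    matApply M ξ = ∑ i, ∑ j, (M i j * ξ j) • EuclideanSpace.single i (1 : ℝ) := by
  ext k
  simp [matApply, Matrix.mulVec, dotProduct, ← Finset.sum_smul, Pi.single_apply]

variable {M}

lemma inner_matApply_comm (hM : M.IsSymm) (ξ η : Euc d) :
    ⟪matApply M ξ, η⟫ = ⟪matApply M η, ξ⟫ := by
  simp only [matApply, EuclideanSpace.inner_eq_star_dotProduct, star_trivial]
  rw [Matrix.dotProduct_mulVec, ← Matrix.mulVec_transpose, hM.eq, dotProduct_comm]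

lemma isUnit_det_of_coercive {c : ℝ} (hc : 0 < c)
    (h : ∀ ξ : Euc d, c * ‖ξ‖ ^ 2 ≤ ⟪matApply M ξ, ξ⟫) : IsUnit M.det := by
  rw [← Matrix.isUnit_iff_isUnit_det, ← Matrix.mulVec_injective_iff_isUnit]
  refine (injective_iff_map_eq_zero M.mulVecLin).2 fun v hv => ?_
  have h1 := h (WithLp.toLp 2 v)
  have h2 : matApply M (WithLp.toLp 2 v) = 0 := by
    ext i; exact congrFun hv i
  rw [h2, inner_zero_left] at h1
  have h3 : ‖(WithLp.toLp 2 v : Euc d)‖ = 0 := by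
    have := sq_nonneg ‖(WithLp.toLp 2 v : Euc d)‖
    exact pow_eq_zero_iff (two_ne_zero) |>.1 (by nlinarith)
  rw [norm_eq_zero] at h3
  simpa using congrArg WithLp.ofLp h3

lemma matApply_matApply_inv (h : IsUnit M.det) (ξ : Euc d) : matApply M (matApply M⁻¹ ξ) = ξ := by
  simp [matApply, Matrix.mulVec_mulVec, Matrix.mul_nonsing_inv _ h]

lemma matApply_inv_matApply (h : IsUnit M.det) (ξ : Euc d) : matApply M⁻¹ (matApply M ξ) = ξ := by
  simp [matApply, Matrix.mulVec_mulVec, Matrix.nonsing_inv_mul _ h]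

/-- Coercivity at `M⁻¹ξ` combined with Cauchy–Schwarz. The bound is uniform in `x`, so `A⁻¹` maps
`L²` into itself. -/
lemma norm_matApply_inv_le {c : ℝ} (hc : 0 < c)
    (h : ∀ ξ : Euc d, c * ‖ξ‖ ^ 2 ≤ ⟪matApply M ξ, ξ⟫) (ξ : Euc d) :
    ‖matApply M⁻¹ ξ‖ ≤ c⁻¹ * ‖ξ‖ := by
  have h1 := h (matApply M⁻¹ ξ)
  rw [matApply_matApply_inv (isUnit_det_of_coercive hc h)] at h1
  have h2 := h1.trans (real_inner_le_norm _ _)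
  rcases (norm_nonneg (matApply M⁻¹ ξ)).eq_or_lt with h0 | h0
  · rw [← h0]; positivity
  · rw [← div_eq_inv_mul, le_div_iff₀ hc]
    nlinarith

lemma inner_matApply_inv_nonneg {c : ℝ} (hc : 0 < c)
    (h : ∀ ξ : Euc d, c * ‖ξ‖ ^ 2 ≤ ⟪matApply M ξ, ξ⟫) (ξ : Euc d) :
    0 ≤ ⟪matApply M⁻¹ ξ, ξ⟫ := by
  have h1 := h (matApply M⁻¹ ξ)
  rw [matApply_matApply_inv (isUnit_det_of_coercive hc h), real_inner_comm] at h1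
  exact le_trans (by positivity) h1

end MatrixApply

/-! ### Integrability of products and `L²` pairings -/

section Integrability

variable {α : Type*} [MeasurableSpace α] {μ : Measure α}

lemma MeasureTheory.MemLp.integrable_mul_fun {f g : α → ℝ} (hf : MemLp f 2 μ)
    (hg : MemLp g 2 μ) : Integrable (fun x => f x * g x) μ := hf.integrable_mul hg

lemma MeasureTheory.MemLp.integrable_inner_fun {E : Type*} [NormedAddCommGroup E]
    [InnerProductSpace ℝ E] {f g : α → E} (hf : MemLp f 2 μ) (hg : MemLp g 2 μ) :
    Integrable (fun x => ⟪f x, g x⟫) μ :=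
  (hf.norm.integrable_mul hg.norm).mono' (hf.1.inner hg.1)
    (.of_forall fun x => norm_inner_le_norm (f x) (g x))

lemma MeasureTheory.Integrable.posPart_fun {f : α → ℝ} (hf : Integrable f μ) :
    Integrable (fun x => (f x)⁺) μ := hf.pos_part

lemma MeasureTheory.Integrable.negPart_fun {f : α → ℝ} (hf : Integrable f μ) :
    Integrable (fun x => (f x)⁻) μ := hf.neg_part

/-- Cauchy–Schwarz against the constant `1`, which is square integrable since the measure is finite.
-/
lemma exists_integral_abs_le [IsFiniteMeasure μ] :
    ∃ C : ℝ, 0 ≤ C ∧ ∀ z : Lp ℝ 2 μ, ∫ x, |z x| ∂μ ≤ C * ‖z‖ := by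
  have h1 : MemLp (fun _ : α => (1 : ℝ)) 2 μ := memLp_const 1
  refine ⟨‖h1.toLp _‖, norm_nonneg _, fun z => ?_⟩
  have hz := (Lp.memLp z).norm
  have e : ⟪h1.toLp _, hz.toLp _⟫ = ∫ x, |z x| ∂μ := by
    rw [L2.inner_def]
    refine integral_congr_ae ?_
    filter_upwards [h1.coeFn_toLp, hz.coeFn_toLp] with x e1 e2
    rw [e1, e2]; simp
  have e2 : ‖hz.toLp _‖ = ‖z‖ := by
    rw [Lp.norm_toLp, eLpNorm_norm, Lp.norm_def]
  rw [← e, ← e2]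
  exact real_inner_le_norm _ _

lemma integral_mul_coe_sub {f : α → ℝ} (hf : MemLp f 2 μ) (a b : Lp ℝ 2 μ) :
    ∫ x, f x * (a - b : Lp ℝ 2 μ) x ∂μ = ∫ x, f x * a x ∂μ - ∫ x, f x * b x ∂μ := by
  rw [← integral_sub (hf.integrable_mul_fun (Lp.memLp a)) (hf.integrable_mul_fun (Lp.memLp b))]
  refine integral_congr_ae ?_
  filter_upwards [Lp.coeFn_sub a b] with x hx
  rw [hx, Pi.sub_apply, mul_sub]

lemma integral_inner_coe_sub {E : Type*} [NormedAddCommGroup E] [InnerProductSpace ℝ E]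
    {f : α → E} (hf : MemLp f 2 μ) (a b : Lp E 2 μ) :
    ∫ x, ⟪f x, (a - b : Lp E 2 μ) x⟫ ∂μ = ∫ x, ⟪f x, a x⟫ ∂μ - ∫ x, ⟪f x, b x⟫ ∂μ := by
  rw [← integral_sub (hf.integrable_inner_fun (Lp.memLp a)) (hf.integrable_inner_fun (Lp.memLp b))]
  refine integral_congr_ae ?_
  filter_upwards [Lp.coeFn_sub a b] with x hx
  rw [hx, Pi.sub_apply, inner_sub_right]

end Integrability

/-! ### Weighted norms and the conjugate of `Ĝ` -/

namespace TwoPhaseProblem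

variable {d : ℕ} {Ω : Opens (Euc d)} (P : TwoPhaseProblem Ω)

lemma memLp_matApply {y : Euc d → Euc d} (hy : MemLp y 2 (leb Ω)) :
    MemLp (fun x => matApply (P.A x) (y x)) 2 (leb Ω) := by
  simp_rw [matApply_eq_sum]
  refine memLp_finsetSum _ fun i _ => memLp_finsetSum _ fun j _ => ?_
  have hj : MemLp (fun x => y x j) 2 (leb Ω) :=
    hy.of_le ((EuclideanSpace.proj (𝕜 := ℝ) j).continuous.comp_aestronglyMeasurable hy.1)
      (.of_forall fun x => PiLp.norm_apply_le (y x) j)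
  have hij : MemLp (fun x => P.A x i j * y x j) 2 (leb Ω) := hj.mul (P.A_bounded i j)
  refine (hij.norm.of_le (hij.1.smul_const _) (.of_forall fun x => ?_))
  simp [norm_smul]

lemma memLp_flux (u : FunGrad Ω) : MemLp (P.flux u) 2 (leb Ω) := P.memLp_matApply (Lp.memLp u.2)

/-- By Cramer's rule the entries of the inverse are polynomials divided by the determinant. -/
lemma aestronglyMeasurable_inv (i j : Fin d) :
    AEStronglyMeasurable (fun x => (P.A x)⁻¹ i j) (leb Ω) := by
  have h : AEMeasurable (fun x => (fun i j => P.A x i j)) (leb Ω) :=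
    aemeasurable_pi_lambda _ fun i => aemeasurable_pi_lambda _ fun j => (P.A_bounded i j).1.aemeasurable
  have hm : Measurable fun M : Fin d → Fin d → ℝ => (Matrix.of M)⁻¹ i j := by
    simp only [Matrix.inv_def, Ring.inverse_eq_inv', Matrix.smul_apply, smul_eq_mul]
    refine Measurable.mul (Measurable.inv ?_) ?_
    · exact (Continuous.matrix_det (by fun_prop)).measurable
    · exact ((Continuous.matrix_adjugate (A := fun M : Fin d → Fin d → ℝ => Matrix.of M)
        (by fun_prop)).matrix_elem i j).measurable
  exact (hm.comp_aemeasurable h).aestronglyMeasurable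

lemma memLp_matApply_inv {y : Euc d → Euc d} (hy : MemLp y 2 (leb Ω)) :
    MemLp (fun x => matApply (P.A x)⁻¹ (y x)) 2 (leb Ω) := by
  obtain ⟨c, hc, h⟩ := P.A_coercive
  refine hy.of_le_mul (c := c⁻¹) ?_ (by
    filter_upwards [h] with x hx
    exact norm_matApply_inv_le hc hx _)
  simp_rw [matApply_eq_sum]
  refine Finset.aestronglyMeasurable_fun_sum _ fun i _ =>
    Finset.aestronglyMeasurable_fun_sum _ fun j _ => ?_
  exact ((P.aestronglyMeasurable_inv i j).mul
    ((EuclideanSpace.proj (𝕜 := ℝ) j).continuous.comp_aestronglyMeasurable hy.1)).smul_const _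

lemma weightedNormSq_congr {B : Euc d → Matrix (Fin d) (Fin d) ℝ} {y z : Euc d → Euc d}
    (h : y =ᵐ[leb Ω] z) : weightedNormSq Ω B y = weightedNormSq Ω B z :=
  integral_congr_ae (by filter_upwards [h] with x hx; rw [hx])

lemma weightedNormSq_add_smul {a b : Euc d → Euc d} (ha : MemLp a 2 (leb Ω))
    (hb : MemLp b 2 (leb Ω)) (s : ℝ) :
    weightedNormSq Ω P.A (fun x => a x + s • b x) = weightedNormSq Ω P.A a
      + 2 * s * ∫ x, ⟪matApply (P.A x) (a x), b x⟫ ∂(leb Ω) + s ^ 2 * weightedNormSq Ω P.A b := by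
  have i1 := (P.memLp_matApply ha).integrable_inner_fun ha
  have i2 := ((P.memLp_matApply ha).integrable_inner_fun hb).const_mul (2 * s)
  have i3 := ((P.memLp_matApply hb).integrable_inner_fun hb).const_mul (s ^ 2)
  simp only [weightedNormSq]
  rw [← integral_const_mul, ← integral_const_mul, ← integral_add i1 i2,
    ← integral_add (i1.fun_add i2) i3]
  refine integral_congr_ae ?_
  filter_upwards [P.A_symm] with x hx
  simp only [matApply_add, matApply_smul, inner_add_left, inner_add_right, inner_smul_left,
    inner_smul_right, inner_matApply_comm hx (b x) (a x)]
  simp; ring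

lemma weightedNormSq_sub {a b : Euc d → Euc d} (ha : MemLp a 2 (leb Ω))
    (hb : MemLp b 2 (leb Ω)) :
    weightedNormSq Ω P.A (fun x => a x - b x) = weightedNormSq Ω P.A a
      - 2 * ∫ x, ⟪matApply (P.A x) (a x), b x⟫ ∂(leb Ω) + weightedNormSq Ω P.A b := by
  have := P.weightedNormSq_add_smul ha hb (-1)
  simp only [neg_smul, one_smul, ← sub_eq_add_neg] at this
  rw [this]; ring

/-- In the cross term `A⁻¹` cancels `A`. The left side is therefore twice the Fenchel gap of the
quadratic energy, the source of every `D_Ĝ` term. -/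
lemma weightedNormSq_inv_sub {a y : Euc d → Euc d} (ha : MemLp a 2 (leb Ω))
    (hy : MemLp y 2 (leb Ω)) :
    weightedNormSq Ω (fun x => (P.A x)⁻¹) (fun x => matApply (P.A x) (a x) - y x)
      = weightedNormSq Ω P.A a - 2 * ∫ x, ⟪y x, a x⟫ ∂(leb Ω)
        + weightedNormSq Ω (fun x => (P.A x)⁻¹) y := by
  have i1 := (P.memLp_matApply ha).integrable_inner_fun ha
  have i2 := (hy.integrable_inner_fun ha).const_mul 2
  have i3 := (P.memLp_matApply_inv hy).integrable_inner_fun hy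
  simp only [weightedNormSq]
  rw [← integral_const_mul, ← integral_sub i1 i2, ← integral_add (i1.sub' i2) i3]
  obtain ⟨c, hc, h⟩ := P.A_coercive
  refine integral_congr_ae ?_
  filter_upwards [P.A_symm, h] with x hs hx
  have hd := isUnit_det_of_coercive hc hx
  have e : ⟪matApply (P.A x)⁻¹ (y x), matApply (P.A x) (a x)⟫ = ⟪y x, a x⟫ := by
    rw [real_inner_comm, inner_matApply_comm hs, matApply_matApply_inv hd]
  simp only [matApply_sub, matApply_inv_matApply hd, inner_sub_left, inner_sub_right, e,
    real_inner_comm]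
  rw [real_inner_comm (y x) (a x)]
  ring

lemma weightedNormSq_inv_nonneg (y : Euc d → Euc d) :
    0 ≤ weightedNormSq Ω (fun x => (P.A x)⁻¹) y := by
  obtain ⟨c, hc, h⟩ := P.A_coercive
  refine integral_nonneg_of_ae ?_
  filter_upwards [h] with x hx
  exact inner_matApply_inv_nonneg hc hx _

lemma weightedNormSq_inv_flux (u : FunGrad Ω) :
    weightedNormSq Ω (fun x => (P.A x)⁻¹) (P.flux u) = weightedNormSq Ω P.A u.2 := by
  obtain ⟨c, hc, h⟩ := P.A_coercive
  refine integral_congr_ae ?_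
  filter_upwards [h] with x hx
  rw [flux, matApply_inv_matApply (isUnit_det_of_coercive hc hx), real_inner_comm]

lemma weightedNormSq_matApply_inv (y : Euc d → Euc d) :
    weightedNormSq Ω P.A (fun x => matApply (P.A x)⁻¹ (y x))
      = ∫ x, ⟪y x, matApply (P.A x)⁻¹ (y x)⟫ ∂(leb Ω) := by
  obtain ⟨c, hc, h⟩ := P.A_coercive
  refine integral_congr_ae ?_
  filter_upwards [h] with x hx
  rw [matApply_matApply_inv (isUnit_det_of_coercive hc hx)]

/-- The conjugate of `Ĝ` in closed form. -/
lemma GhatStar_eq {y : Euc d → Euc d} (hy : MemLp y 2 (leb Ω)) :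
    P.GhatStar y = ((1 / 2 * weightedNormSq Ω (fun x => (P.A x)⁻¹) y
      - ∫ x, ⟪y x, P.uD.2 x⟫ ∂(leb Ω) : ℝ) : EReal) := by
  have hg := Lp.memLp P.uD.2
  refine le_antisymm (iSup_le fun z => EReal.coe_le_coe_iff.2 ?_) ?_
  · have hz := Lp.memLp z
    -- The Fenchel–Young inequality is the nonnegativity of `‖A(z + ∇u_D) - y‖²_{A⁻¹}`.
    have h1 := P.weightedNormSq_inv_nonneg
      (fun x => matApply (P.A x) ((z + P.uD.2 : Euc d → Euc d) x) - y x)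
    rw [P.weightedNormSq_inv_sub (hz.add hg) hy] at h1
    have h2 : ∫ x, ⟪y x, (z + P.uD.2 : Euc d → Euc d) x⟫ ∂(leb Ω)
        = ∫ x, ⟪y x, z x⟫ ∂(leb Ω) + ∫ x, ⟪y x, P.uD.2 x⟫ ∂(leb Ω) := by
      rw [← integral_add (hy.integrable_inner_fun hz) (hy.integrable_inner_fun hg)]
      simp only [Pi.add_apply, inner_add_right]
    have h3 : P.Ghat z = 1 / 2 * weightedNormSq Ω P.A (z + P.uD.2 : Euc d → Euc d) := rfl
    linarith
  · have hb := P.memLp_matApply_inv hy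
    -- The maximizer `A⁻¹y - ∇u_D` makes that square vanish.
    refine le_iSup_of_le (hb.toLp _ - P.uD.2) (EReal.coe_le_coe_iff.2 (le_of_eq ?_))
    have h1 : P.Ghat (hb.toLp _ - P.uD.2 : L2Vec Ω)
        = 1 / 2 * weightedNormSq Ω P.A (fun x => matApply (P.A x)⁻¹ (y x)) := by
      rw [Ghat]
      congr 1
      apply weightedNormSq_congr
      filter_upwards [hb.coeFn_toLp, Lp.coeFn_sub (hb.toLp _) P.uD.2] with x h1 h2
      rw [h2, Pi.sub_apply, h1, sub_add_cancel]
    have h2 : ∫ x, ⟪y x, hb.toLp _ x⟫ ∂(leb Ω)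
        = ∫ x, ⟪y x, matApply (P.A x)⁻¹ (y x)⟫ ∂(leb Ω) :=
      integral_congr_ae (by filter_upwards [hb.coeFn_toLp] with x hx; rw [hx])
    have h3 : weightedNormSq Ω (fun x => (P.A x)⁻¹) y
        = ∫ x, ⟪y x, matApply (P.A x)⁻¹ (y x)⟫ ∂(leb Ω) := by
      simp only [weightedNormSq, real_inner_comm]
    rw [integral_inner_coe_sub hy, h1, h2, P.weightedNormSq_matApply_inv, h3]
    ring

end TwoPhaseProblem

/-! ### Pointwise bounds for the phase potential -/

section PhasePotential

variable {αp αm h t : ℝ}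

lemma phasePotential_sub_nonneg (hh : h ∈ Set.Icc (-αm) αp) : 0 ≤ αp * t⁺ + αm * t⁻ - h * t := by
  rcases le_total 0 t with ht | ht
  · rw [posPart_eq_self.2 ht, negPart_eq_zero.2 ht]
    nlinarith [hh.2]
  · rw [posPart_eq_zero.2 ht, negPart_eq_neg.2 ht]
    nlinarith [hh.1]

lemma phasePotential_sub_le (hh : h ∈ Set.Icc (-αm) αp) :
    αp * t⁺ + αm * t⁻ - h * t ≤ (αp + αm) * |t| := by
  rcases le_total 0 t with ht | ht
  · rw [posPart_eq_self.2 ht, negPart_eq_zero.2 ht, abs_of_nonneg ht]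
    nlinarith [hh.1]
  · rw [posPart_eq_zero.2 ht, negPart_eq_neg.2 ht, abs_of_nonpos ht]
    nlinarith [hh.2]

end PhasePotential

lemma isFiniteMeasure_leb {d : ℕ} {Ω : Opens (Euc d)}
    (hΩ : Bornology.IsBounded (Ω : Set (Euc d))) : IsFiniteMeasure (leb Ω) :=
  ⟨by simpa using hΩ.measure_lt_top⟩

/-! ### The conjugate of `F̂` and closed forms of the compound functionals -/

namespace TwoPhaseProblem

variable {d : ℕ} {Ω : Opens (Euc d)} (P : TwoPhaseProblem Ω)

/-- The part `∫ (α₊ z₊ + α₋ z₋ - f z)` of the energy that does not contain the gradient. -/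
noncomputable def potential (z : Euc d → ℝ) : ℝ :=
  ∫ x, (P.αp * (z x)⁺ + P.αm * (z x)⁻ - P.f x * z x) ∂(leb Ω)

lemma potential_congr {z z' : Euc d → ℝ} (h : z =ᵐ[leb Ω] z') :
    P.potential z = P.potential z' :=
  integral_congr_ae (by filter_upwards [h] with x hx; rw [hx])

lemma Fhat_eq_potential (w : FunGrad Ω) :
    P.Fhat w = P.potential (w + P.uD).1 := by
  refine integral_congr_ae ?_
  filter_upwards [Lp.coeFn_add w.1 P.uD.1] with x hx
  rw [Prod.fst_add, hx, Pi.add_apply]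
  ring

lemma Fhat_sub (v : FunGrad Ω) : P.Fhat (v - P.uD) = P.potential v.1 := by
  rw [Fhat_eq_potential, sub_add_cancel]

lemma upsilon_nonneg (v : FunGrad Ω) {q : Euc d → ℝ}
    (hq : ∀ᵐ x ∂(leb Ω), q x + P.f x ∈ Set.Icc (-P.αm) P.αp) : 0 ≤ P.Upsilon v q := by
  refine integral_nonneg_of_ae ?_
  filter_upwards [hq] with x hx
  rw [add_comm] at hx
  exact phasePotential_sub_nonneg hx

lemma DG_eq {y : Euc d → Euc d} (hy : MemLp y 2 (leb Ω)) (v : FunGrad Ω) :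
    P.DG ((v - P.uD).2 : L2Vec Ω) y = ((1 / 2 * weightedNormSq Ω (fun x => (P.A x)⁻¹)
        (fun x => P.flux v x - y x) : ℝ) : EReal) := by
  have h : P.Ghat ((v - P.uD).2 : L2Vec Ω) = 1 / 2 * weightedNormSq Ω P.A v.2 := by
    rw [Ghat]
    congr 1
    apply weightedNormSq_congr
    filter_upwards [Lp.coeFn_sub v.2 P.uD.2] with x hx
    rw [Prod.snd_sub, hx, Pi.sub_apply, sub_add_cancel]
  rw [DG, P.GhatStar_eq hy, ← EReal.coe_add, ← EReal.coe_sub, EReal.coe_eq_coe_iff, h,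
    Prod.snd_sub, integral_inner_coe_sub hy]
  have := P.weightedNormSq_inv_sub (Lp.memLp v.2) hy
  simp only [flux]
  linarith

/-- The complementarity conditions: `r + f` is a subgradient of the phase potential at `u`. -/
noncomputable def IsComplementary (u : FunGrad Ω) (r : Euc d → ℝ) : Prop :=
  ∀ᵐ x ∂(leb Ω), (0 < u.1 x → r x + P.f x = P.αp) ∧ (u.1 x < 0 → r x + P.f x = -P.αm)

variable {P} in
-- The integrand is the pointwise Fenchel gap: it vanishes where `u = 0`, and complementarity
-- removes it where `u ≠ 0`.
lemma IsComplementary.upsilon_eq_zero {u : FunGrad Ω} {r : Euc d → ℝ}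
    (h : P.IsComplementary u r) : P.Upsilon u r = 0 := by
  refine integral_eq_zero_of_ae ?_
  filter_upwards [h] with x hx
  rw [add_comm (P.f x), Pi.zero_apply]
  rcases lt_trichotomy (u.1 x) 0 with h0 | h0 | h0
  · rw [hx.2 h0, posPart_eq_zero.2 h0.le, negPart_eq_neg.2 h0.le]; ring
  · rw [h0]; simp
  · rw [hx.1 h0, posPart_eq_self.2 h0.le, negPart_eq_zero.2 h0.le]; ring

variable {P} in
lemma IsComplementary.upsilon_eq_integral_phaseWeight {u : FunGrad Ω} {r : Euc d → ℝ}
    (h : P.IsComplementary u r) (h0 : ∀ᵐ x ∂(leb Ω), u.1 x = 0 → r x + P.f x = 0)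
    (v : FunGrad Ω) :
    P.Upsilon v r = ∫ x, phaseWeight P.αp P.αm (u.1 x) (v.1 x) * |v.1 x| ∂(leb Ω) := by
  refine integral_congr_ae ?_
  filter_upwards [h, h0] with x hx hx0
  simp only [phaseWeight]
  rw [add_comm (P.f x)]
  rcases lt_trichotomy (u.1 x) 0 with hu | hu | hu <;>
    rcases lt_trichotomy (v.1 x) 0 with hv | hv | hv
  · rw [hx.2 hu, posPart_eq_zero.2 hv.le, negPart_eq_neg.2 hv.le]
    simp [hu.ne, hv.not_gt, hu.not_gt]
  · simp [hv]
  · rw [hx.2 hu, posPart_eq_self.2 hv.le, negPart_eq_zero.2 hv.le]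
    simp [hu.ne, hv, hu, abs_of_pos hv]; ring
  · rw [hx0 hu, posPart_eq_zero.2 hv.le, negPart_eq_neg.2 hv.le]
    simp [hu, hv, hv.not_gt, abs_of_neg hv]
  · simp [hv]
  · rw [hx0 hu, posPart_eq_self.2 hv.le, negPart_eq_zero.2 hv.le]
    simp [hu, hv, abs_of_pos hv]
  · rw [hx.1 hu, posPart_eq_zero.2 hv.le, negPart_eq_neg.2 hv.le]
    simp [hu.ne', hv, hu, hv.not_gt, abs_of_neg hv]; ring
  · simp [hv]
  · rw [hx.1 hu, posPart_eq_self.2 hv.le, negPart_eq_zero.2 hv.le]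
    simp [hu.ne', hv.not_gt, hu.not_gt]

variable [IsFiniteMeasure (leb Ω)]

lemma memLp_f : MemLp P.f 2 (leb Ω) := P.f_bounded.mono_exponent le_top

lemma integrable_phase {z : Euc d → ℝ} (hz : MemLp z 2 (leb Ω)) :
    Integrable (fun x => P.αp * (z x)⁺ + P.αm * (z x)⁻) (leb Ω) := by
  have h := hz.integrable (by norm_num)
  exact (h.posPart_fun.const_mul _).add (h.negPart_fun.const_mul _)

lemma integrable_potential {z : Euc d → ℝ} (hz : MemLp z 2 (leb Ω)) :
    Integrable (fun x => P.αp * (z x)⁺ + P.αm * (z x)⁻ - P.f x * z x) (leb Ω) :=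
  (P.integrable_phase hz).sub (P.memLp_f.integrable_mul_fun hz)

lemma integrable_upsilon {z q : Euc d → ℝ} (hz : MemLp z 2 (leb Ω)) (hq : MemLp q 2 (leb Ω)) :
    Integrable (fun x => P.αp * (z x)⁺ + P.αm * (z x)⁻ - (P.f x + q x) * z x) (leb Ω) :=
  (P.integrable_phase hz).sub ((P.memLp_f.add hq).integrable_mul_fun hz)

lemma J_eq (v : FunGrad Ω) : P.J v = 1 / 2 * weightedNormSq Ω P.A v.2 + P.potential v.1 := by
  have i1 := ((P.memLp_flux v).integrable_inner_fun (Lp.memLp v.2)).const_mul (1 / 2)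
  rw [weightedNormSq, ← integral_const_mul, potential]
  refine Eq.trans ?_ (integral_add i1 (P.integrable_potential (Lp.memLp v.1)))
  refine integral_congr_ae (.of_forall fun x => ?_)
  simp only
  ring

lemma upsilon_eq (v : FunGrad Ω) {q : Euc d → ℝ} (hq : MemLp q 2 (leb Ω)) :
    P.Upsilon v q = P.potential v.1 - ∫ x, q x * v.1 x ∂(leb Ω) := by
  rw [potential, ← integral_sub (P.integrable_potential (Lp.memLp v.1))
    (hq.integrable_mul_fun (Lp.memLp v.1))]
  refine integral_congr_ae (.of_forall fun x => ?_)
  simp only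
  ring

lemma upsilon_le (v : FunGrad Ω) {q : Euc d → ℝ} (hq2 : MemLp q 2 (leb Ω))
    (hq : ∀ᵐ x ∂(leb Ω), q x + P.f x ∈ Set.Icc (-P.αm) P.αp) :
    P.Upsilon v q ≤ (P.αp + P.αm) * ∫ x, |v.1 x| ∂(leb Ω) := by
  have hv := Lp.memLp v.1
  rw [← integral_const_mul]
  refine integral_mono_ae (P.integrable_upsilon hv hq2)
    ((hv.integrable (by norm_num)).abs.const_mul _) ?_
  filter_upwards [hq] with x hx
  rw [add_comm] at hx
  exact phasePotential_sub_le hx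

/-- The conjugate of `F̂` at `-Λ*y` is determined by the boundary values alone. -/
lemma FhatStar_eq {y : Euc d → Euc d} {q : Euc d → ℝ} (hy : P.IsAdmissibleFlux y q) :
    P.FhatStar (negAdjGrad y) = ((- ∫ x, q x * P.uD.1 x ∂(leb Ω) : ℝ) : EReal) := by
  obtain ⟨hy2, hq2, hdiv, hq⟩ := hy
  -- Integration by parts leaves a constant minus a nonnegative term, so the supremum amounts to
  -- driving `Υ` to `0`.
  have key : ∀ w ∈ H10 Ω, negAdjGrad y w - P.Fhat w
      = - ∫ x, q x * P.uD.1 x ∂(leb Ω) - P.Upsilon (w + P.uD) q := by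
    intro w hw
    have h1 := integral_mul_coe_sub hq2 (w + P.uD).1 P.uD.1
    rw [Prod.fst_add, add_sub_cancel_right] at h1
    rw [negAdjGrad, hdiv.integral_inner_eq hy2 hq2 hw, P.upsilon_eq _ hq2, Fhat_eq_potential,
      Prod.fst_add]
    linarith
  refine le_antisymm (iSup₂_le fun w hw => EReal.coe_le_coe_iff.2 ?_) ?_
  · rw [key w hw]
    linarith [P.upsilon_nonneg (w + P.uD) hq]
  · obtain ⟨C, hC, hCz⟩ := exists_integral_abs_le (μ := leb Ω)
    -- The natural maximizer `w = -u_D` need not lie in `V₀`, so it is approximated in `L²(Ω)`.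
    refine EReal.ge_of_forall_gt_iff_ge.1 fun s hs => ?_
    rw [EReal.coe_lt_coe_iff] at hs
    have hα := add_pos P.αp_pos P.αm_pos
    -- `D` bounds `Υ` by a multiple of the `L²` norm; the `+ 1` keeps it positive even if `C = 0`.
    set D := (P.αp + P.αm) * C + 1 with hD
    have hDpos : 0 < D := by positivity
    obtain ⟨w, hw, hlt⟩ := exists_mem_H10_norm_sub_lt (-P.uD.1)
      (div_pos (sub_pos.2 hs) hDpos)
    refine le_iSup₂_of_le w hw (EReal.coe_le_coe_iff.2 ?_)
    rw [key w hw]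
    have h1 : ‖(w + P.uD).1‖ ≤ (- ∫ x, q x * P.uD.1 x ∂(leb Ω) - s) / D := by
      rw [← norm_neg, Prod.fst_add, neg_add']
      rw [← norm_neg] at hlt
      refine le_of_eq_of_le ?_ hlt.le
      rw [← norm_neg]
      congr 1
      abel
    have h2 := (P.upsilon_le (w + P.uD) hq2 hq).trans
      (mul_le_mul_of_nonneg_left (hCz (w + P.uD).1) hα.le)
    have h3 := mul_le_mul_of_nonneg_left h1 hDpos.le
    rw [mul_div_cancel₀ _ hDpos.ne'] at h3
    have h4 := norm_nonneg (w + P.uD).1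
    nlinarith

lemma DF_eq {y : Euc d → Euc d} {q : Euc d → ℝ} (hy : P.IsAdmissibleFlux y q) {v : FunGrad Ω}
    (hv : v ∈ P.affineSpace) :
    P.DF (v - P.uD) (negAdjGrad y) = (P.Upsilon v q : EReal) := by
  rw [DF, P.FhatStar_eq hy, ← EReal.coe_add, ← EReal.coe_sub, EReal.coe_eq_coe_iff, Fhat_sub,
    negAdjGrad, hy.2.2.1.integral_inner_eq hy.1 hy.2.1 hv, P.upsilon_eq v hy.2.1, Prod.fst_sub,
    integral_mul_coe_sub hy.2.1]
  ring

lemma Istar_eq {y : Euc d → Euc d} {q : Euc d → ℝ} (hy : P.IsAdmissibleFlux y q) :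
    P.Istar y = ((- (1 / 2) * weightedNormSq Ω (fun x => (P.A x)⁻¹) y
      + ∫ x, (⟪y x, P.uD.2 x⟫ + q x * P.uD.1 x) ∂(leb Ω) : ℝ) : EReal) := by
  rw [Istar, P.GhatStar_eq hy.1, P.FhatStar_eq hy, ← EReal.coe_neg, ← EReal.coe_sub,
    EReal.coe_eq_coe_iff, integral_add (hy.1.integrable_inner_fun (Lp.memLp _))
      (hy.2.1.integrable_mul_fun (Lp.memLp _))]
  ring

lemma upsilon_eq_setIntegral (v : FunGrad Ω) {q : Euc d → ℝ} (hq : MemLp q 2 (leb Ω)) :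
    P.Upsilon v q = ∫ x in {x | 0 < v.1 x}, (P.αp - (q x + P.f x)) * v.1 x ∂(leb Ω)
      + ∫ x in {x | v.1 x < 0}, (-P.αm - (q x + P.f x)) * v.1 x ∂(leb Ω) := by
  have hm : Measurable (v.1 : Euc d → ℝ) := (Lp.stronglyMeasurable v.1).measurable
  have m1 : MeasurableSet {x | 0 < v.1 x} := measurableSet_lt measurable_const hm
  have m2 : MeasurableSet {x | v.1 x < 0} := measurableSet_lt hm measurable_const
  have hv := Lp.memLp v.1
  have i1 : Integrable (fun x => (P.αp - (q x + P.f x)) * v.1 x) (leb Ω) :=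
    ((memLp_const P.αp).sub (hq.add P.memLp_f)).integrable_mul_fun hv
  have i2 : Integrable (fun x => (-P.αm - (q x + P.f x)) * v.1 x) (leb Ω) :=
    ((memLp_const (-P.αm)).sub (hq.add P.memLp_f)).integrable_mul_fun hv
  rw [← integral_indicator m1, ← integral_indicator m2,
    ← integral_add (i1.indicator m1) (i2.indicator m2)]
  refine integral_congr_ae (.of_forall fun x => ?_)
  rcases lt_trichotomy (v.1 x) 0 with h | h | h
  · simp [Set.indicator, h, h.not_gt, posPart_eq_zero.2 h.le, negPart_eq_neg.2 h.le]; ring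
  · simp [Set.indicator, h]
  · simp [Set.indicator, h, h.not_gt, posPart_eq_self.2 h.le, negPart_eq_zero.2 h.le]; ring

end TwoPhaseProblem

/-! ### One-sided derivative of the phase potential -/

/-- The directional derivative at `a` in the direction `b` of `t ↦ α₊ t₊ + α₋ t₋`. -/
noncomputable def phaseDeriv (αp αm a b : ℝ) : ℝ :=
  if 0 < a then αp * b else if a < 0 then -αm * b else αp * b⁺ + αm * b⁻

section PhaseDeriv

variable {αp αm : ℝ}

lemma phaseDeriv_mul (a b : ℝ) {c : ℝ} (hc : 0 ≤ c) :
    phaseDeriv αp αm a (c * b) = c * phaseDeriv αp αm a b := by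
  unfold phaseDeriv
  split_ifs
  · ring
  · ring
  · rw [posPart_def, negPart_def, posPart_def, negPart_def, ← mul_neg]
    rw [show (0 : ℝ) = c * 0 by simp, ← mul_max_of_nonneg _ _ hc, ← mul_max_of_nonneg _ _ hc]
    simp only [mul_zero]
    ring

lemma phaseDeriv_zero (a : ℝ) : phaseDeriv αp αm a 0 = 0 := by
  simp [phaseDeriv]

lemma phaseDeriv_add_le (hp : 0 < αp) (hm : 0 < αm) (a b c : ℝ) :
    phaseDeriv αp αm a (b + c) ≤ phaseDeriv αp αm a b + phaseDeriv αp αm a c := by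
  unfold phaseDeriv
  split_ifs
  · linarith
  · linarith
  · have h1 : (b + c)⁺ ≤ b⁺ + c⁺ := by
      rw [posPart_def, posPart_def, posPart_def]
      exact max_le (add_le_add le_sup_left le_sup_left) (add_nonneg le_sup_right le_sup_right)
    have h2 : (b + c)⁻ ≤ b⁻ + c⁻ := by
      rw [negPart_def, negPart_def, negPart_def, neg_add]
      exact max_le (add_le_add le_sup_left le_sup_left) (add_nonneg le_sup_right le_sup_right)
    nlinarith

lemma abs_phaseDeriv_le (hp : 0 < αp) (hm : 0 < αm) (a b : ℝ) :
    |phaseDeriv αp αm a b| ≤ (αp + αm) * |b| := by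
  have hb := abs_nonneg b
  unfold phaseDeriv
  split_ifs
  · rw [abs_mul, abs_of_pos hp]; nlinarith
  · rw [abs_mul, abs_neg, abs_of_pos hm]; nlinarith
  · have h1 := posPart_nonneg b
    have h2 := negPart_nonneg b
    rw [abs_of_nonneg (by positivity), ← posPart_add_negPart b]
    nlinarith

lemma measurable_phaseDeriv : Measurable fun p : ℝ × ℝ => phaseDeriv αp αm p.1 p.2 := by
  unfold phaseDeriv
  refine Measurable.ite (measurableSet_lt measurable_const measurable_fst)
    (measurable_snd.const_mul _) (Measurable.ite (measurableSet_lt measurable_fst measurable_const)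
      (measurable_snd.const_mul _) ?_)
  have h1 : Continuous fun p : ℝ × ℝ => αp * p.2⁺ + αm * p.2⁻ := by
    simp only [posPart_def, negPart_def]
    fun_prop
  exact h1.measurable

/-- This Lipschitz bound supplies the dominating function for the difference quotients. -/
lemma abs_phase_sub_le (hp : 0 < αp) (hm : 0 < αm) (a b : ℝ) :
    |(αp * (a + b)⁺ + αm * (a + b)⁻) - (αp * a⁺ + αm * a⁻)| ≤ (αp + αm) * |b| := by
  have h1 : |(a + b)⁺ - a⁺| ≤ |b| := by
    have := abs_max_sub_max_le_abs (a + b) a 0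
    simpa [posPart_def] using this
  have h2 : |(a + b)⁻ - a⁻| ≤ |b| := by
    have := abs_max_sub_max_le_abs (-(a + b)) (-a) 0
    rw [negPart_def, negPart_def]
    refine this.trans (le_of_eq ?_)
    rw [show -(a + b) - -a = -b by ring, abs_neg]
  calc _ = |αp * ((a + b)⁺ - a⁺) + αm * ((a + b)⁻ - a⁻)| := by congr 1; ring
    _ ≤ αp * |(a + b)⁺ - a⁺| + αm * |(a + b)⁻ - a⁻| := by
      refine (abs_add_le _ _).trans ?_
      rw [abs_mul, abs_mul, abs_of_pos hp, abs_of_pos hm]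
    _ ≤ _ := by nlinarith

open Filter Topology in
lemma tendsto_phase_quotient (a b : ℝ) :
    Tendsto (fun t : ℝ => ((αp * (a + t * b)⁺ + αm * (a + t * b)⁻) - (αp * a⁺ + αm * a⁻)) / t)
      (𝓝[>] 0) (𝓝 (phaseDeriv αp αm a b)) := by
  have hlim : Tendsto (fun t : ℝ => a + t * b) (𝓝[>] 0) (𝓝 a) := by
    have : Continuous fun t : ℝ => a + t * b := by fun_prop
    have h := this.tendsto 0
    simp only [zero_mul, add_zero] at h
    exact h.mono_left nhdsWithin_le_nhds
  -- The quotient is eventually constant: for small `t` the sign of `a + t b` is that of `a`, and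
  -- for `a = 0` positive homogeneity applies.
  refine tendsto_const_nhds.congr' ?_
  rcases lt_trichotomy a 0 with ha | ha | ha
  · filter_upwards [hlim.eventually (gt_mem_nhds ha), self_mem_nhdsWithin] with t h1 h2
    have ht : t ≠ 0 := ne_of_gt h2
    rw [posPart_eq_zero.2 h1.le, negPart_eq_neg.2 h1.le, posPart_eq_zero.2 ha.le,
      negPart_eq_neg.2 ha.le, phaseDeriv, if_neg ha.not_gt, if_pos ha]
    field_simp
    ring
  · filter_upwards [self_mem_nhdsWithin] with t h2
    have ht : (0 : ℝ) < t := h2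
    have h3 := phaseDeriv_mul (αp := αp) (αm := αm) 0 b ht.le
    have h4 : phaseDeriv αp αm 0 (t * b) = αp * (t * b)⁺ + αm * (t * b)⁻ := by
      simp [phaseDeriv]
    rw [ha, zero_add, ← h4, h3]
    simp [ht.ne']
  · filter_upwards [hlim.eventually (lt_mem_nhds ha), self_mem_nhdsWithin] with t h1 h2
    have ht : t ≠ 0 := ne_of_gt h2
    rw [posPart_eq_self.2 h1.le, negPart_eq_zero.2 h1.le, posPart_eq_self.2 ha.le,
      negPart_eq_zero.2 ha.le, phaseDeriv, if_pos ha]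
    field_simp
    ring

end PhaseDeriv

/-! ### Variational inequality and square integrable divergence of `p*` -/

namespace TwoPhaseProblem

variable {d : ℕ} {Ω : Opens (Euc d)} (P : TwoPhaseProblem Ω)

/-- The directional derivative of `z ↦ ∫ (α₊ z₊ + α₋ z₋)`. -/
noncomputable def phaseSlope (u z : L2 Ω) : ℝ :=
  ∫ x, phaseDeriv P.αp P.αm (u x) (z x) ∂(leb Ω)

lemma phaseSlope_smul (u z : L2 Ω) {c : ℝ} (hc : 0 ≤ c) :
    P.phaseSlope u (c • z) = c * P.phaseSlope u z := by
  rw [phaseSlope, phaseSlope, ← integral_const_mul]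
  refine integral_congr_ae ?_
  filter_upwards [Lp.coeFn_smul c z] with x hx
  rw [hx, Pi.smul_apply, smul_eq_mul, phaseDeriv_mul _ _ hc]

lemma mem_affineSpace {P : TwoPhaseProblem Ω} {v : FunGrad Ω} :
    v ∈ P.affineSpace ↔ v - P.uD ∈ H10 Ω := Iff.rfl

lemma add_smul_mem_affineSpace {u w : FunGrad Ω}
    (hu : u ∈ P.affineSpace) (hw : w ∈ H10 Ω) (t : ℝ) : u + t • w ∈ P.affineSpace := by
  rw [mem_affineSpace, ← mem_sobolevZero] at hu ⊢
  rw [← mem_sobolevZero] at hw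
  have h := (sobolevZero Ω).add_mem hu ((sobolevZero Ω).smul_mem t hw)
  rwa [add_sub_right_comm]

variable [IsFiniteMeasure (leb Ω)]

lemma integrable_phaseDeriv (u z : L2 Ω) :
    Integrable (fun x => phaseDeriv P.αp P.αm (u x) (z x)) (leb Ω) := by
  refine Integrable.mono' (g := fun x => (P.αp + P.αm) * |z x|)
    (((Lp.memLp z).integrable (by norm_num)).abs.const_mul _) ?_
    (.of_forall fun x => abs_phaseDeriv_le P.αp_pos P.αm_pos _ _)
  exact (measurable_phaseDeriv.comp_aemeasurable
    ((Lp.aestronglyMeasurable u).aemeasurable.prodMk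
      (Lp.aestronglyMeasurable z).aemeasurable)).aestronglyMeasurable

lemma phaseSlope_add_le (u z z' : L2 Ω) :
    P.phaseSlope u (z + z') ≤ P.phaseSlope u z + P.phaseSlope u z' := by
  rw [phaseSlope, phaseSlope, phaseSlope,
    ← integral_add (P.integrable_phaseDeriv u z) (P.integrable_phaseDeriv u z')]
  refine integral_mono_ae (P.integrable_phaseDeriv u _)
    ((P.integrable_phaseDeriv u z).add (P.integrable_phaseDeriv u z')) ?_
  filter_upwards [Lp.coeFn_add z z'] with x hx
  rw [hx]
  exact phaseDeriv_add_le P.αp_pos P.αm_pos _ _ _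

lemma phaseSlope_le (u z : L2 Ω) :
    P.phaseSlope u z ≤ (P.αp + P.αm) * ∫ x, |z x| ∂(leb Ω) := by
  rw [← integral_const_mul]
  exact integral_mono (P.integrable_phaseDeriv u z)
    (((Lp.memLp z).integrable (by norm_num)).abs.const_mul _)
    fun x => (le_abs_self _).trans (abs_phaseDeriv_le P.αp_pos P.αm_pos _ _)

open Filter Topology in
lemma tendsto_integral_phase_quotient (u z : L2 Ω) :
    Tendsto (fun t : ℝ => ∫ x, ((P.αp * (u x + t * z x)⁺ + P.αm * (u x + t * z x)⁻)
      - (P.αp * (u x)⁺ + P.αm * (u x)⁻)) / t ∂(leb Ω)) (𝓝[>] 0) (𝓝 (P.phaseSlope u z)) := by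
  have hu := Lp.memLp u
  have hz := Lp.memLp z
  refine tendsto_integral_filter_of_dominated_convergence
    (fun x => (P.αp + P.αm) * |z x|) ?_ ?_
    ((hz.integrable (by norm_num)).abs.const_mul _)
    (.of_forall fun x => tendsto_phase_quotient _ _)
  · exact .of_forall fun t => (((P.integrable_phase (hu.add (hz.const_mul t))).sub
      (P.integrable_phase hu)).div_const t).1
  · filter_upwards [self_mem_nhdsWithin] with t ht
    have ht : (0 : ℝ) < t := ht
    refine .of_forall fun x => ?_
    have h := abs_phase_sub_le P.αp_pos P.αm_pos (u x) (t * z x)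
    rw [Real.norm_eq_abs, abs_div, abs_of_pos ht, div_le_iff₀ ht]
    rw [abs_mul, abs_of_pos ht] at h
    linarith

/-- The expansion of the energy along a line. -/
lemma J_add_smul_sub (u w : FunGrad Ω) (t : ℝ) :
    P.J (u + t • w) - P.J u = t * (∫ x, ⟪P.flux u x, w.2 x⟫ ∂(leb Ω)
        - ∫ x, P.f x * w.1 x ∂(leb Ω)) + t ^ 2 / 2 * weightedNormSq Ω P.A w.2
      + ∫ x, ((P.αp * (u.1 x + t * w.1 x)⁺ + P.αm * (u.1 x + t * w.1 x)⁻)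
        - (P.αp * (u.1 x)⁺ + P.αm * (u.1 x)⁻)) ∂(leb Ω) := by
  have hu := Lp.memLp u.1
  have hw := Lp.memLp w.1
  have huw : MemLp (fun x => u.1 x + t * w.1 x) 2 (leb Ω) := hu.add (hw.const_mul t)
  have h1 : weightedNormSq Ω P.A (u + t • w).2
      = weightedNormSq Ω P.A (fun x => u.2 x + t • w.2 x) := by
    apply weightedNormSq_congr
    filter_upwards [Lp.coeFn_add u.2 (t • w.2), Lp.coeFn_smul t w.2] with x e1 e2
    rw [Prod.snd_add, Prod.smul_snd, e1, Pi.add_apply, e2, Pi.smul_apply]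
  have h2 : P.potential (u + t • w).1 = P.potential (fun x => u.1 x + t * w.1 x) := by
    apply potential_congr
    filter_upwards [Lp.coeFn_add u.1 (t • w.1), Lp.coeFn_smul t w.1] with x e1 e2
    rw [Prod.fst_add, Prod.smul_fst, e1, Pi.add_apply, e2, Pi.smul_apply, smul_eq_mul]
  have h3 : P.potential (fun x => u.1 x + t * w.1 x) - P.potential u.1
      = ∫ x, ((P.αp * (u.1 x + t * w.1 x)⁺ + P.αm * (u.1 x + t * w.1 x)⁻)
        - (P.αp * (u.1 x)⁺ + P.αm * (u.1 x)⁻)) ∂(leb Ω)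
        - t * ∫ x, P.f x * w.1 x ∂(leb Ω) := by
    rw [potential, potential, ← integral_const_mul,
      ← integral_sub (P.integrable_potential huw) (P.integrable_potential hu),
      ← integral_sub ((P.integrable_phase huw).sub' (P.integrable_phase hu))
        ((P.memLp_f.integrable_mul_fun hw).const_mul t)]
    refine integral_congr_ae (.of_forall fun x => ?_)
    simp only
    ring
  rw [J_eq, J_eq, h1, P.weightedNormSq_add_smul (Lp.memLp u.2) (Lp.memLp w.2), h2]
  simp only [flux]
  linarith

variable {P}

open Filter Topology in
/-- The variational inequality satisfied by a minimizer. -/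
lemma IsMinimizer.le_phaseSlope {u : FunGrad Ω} (hu : P.IsMinimizer u) {w : FunGrad Ω}
    (hw : w ∈ H10 Ω) :
    ∫ x, P.f x * w.1 x ∂(leb Ω) - ∫ x, ⟪P.flux u x, w.2 x⟫ ∂(leb Ω)
      ≤ P.phaseSlope u.1 w.1 := by
  have hlim : Tendsto (fun t : ℝ => t / 2 * weightedNormSq Ω P.A w.2
      + ∫ x, ((P.αp * (u.1 x + t * w.1 x)⁺ + P.αm * (u.1 x + t * w.1 x)⁻)
      - (P.αp * (u.1 x)⁺ + P.αm * (u.1 x)⁻)) / t ∂(leb Ω)) (𝓝[>] 0)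
      (𝓝 (P.phaseSlope u.1 w.1)) := by
    have h0 : Tendsto (fun t : ℝ => t / 2 * weightedNormSq Ω P.A w.2) (𝓝[>] 0) (𝓝 0) := by
      have : Continuous fun t : ℝ => t / 2 * weightedNormSq Ω P.A w.2 := by fun_prop
      have h := this.tendsto 0
      simp only [zero_div, zero_mul] at h
      exact h.mono_left nhdsWithin_le_nhds
    simpa using h0.add (P.tendsto_integral_phase_quotient u.1 w.1)
  refine ge_of_tendsto hlim ?_
  filter_upwards [self_mem_nhdsWithin] with t ht
  have ht : (0 : ℝ) < t := ht
  have hmem : u + t • w ∈ P.affineSpace := by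
    exact P.add_smul_mem_affineSpace hu.1 hw t
  have h := sub_nonneg.2 (hu.2 _ hmem)
  rw [J_add_smul_sub] at h
  rw [integral_div]
  rw [← sub_nonneg]
  refine (div_nonneg h ht.le).trans (le_of_eq ?_)
  field_simp
  ring

/-- A functional on `L²(Ω)` represented by `h` and dominated by the phase slope at `u` has
`h` in the subdifferential of the phase potential at `u`. -/
lemma ae_le_phaseDeriv_of_le_phaseSlope (P : TwoPhaseProblem Ω) {u h : L2 Ω}
    (H : ∀ z : L2 Ω, ∫ x, h x * z x ∂(leb Ω) ≤ P.phaseSlope u z) (c : ℝ) :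
    ∀ᵐ x ∂(leb Ω), h x * c ≤ phaseDeriv P.αp P.αm (u x) c := by
  have hc : MemLp (fun _ : Euc d => c) 2 (leb Ω) := memLp_const c
  have i1 : Integrable (fun x => h x * c) (leb Ω) := (Lp.memLp h).integrable_mul_fun hc
  have i2 : Integrable (fun x => phaseDeriv P.αp P.αm (u x) c) (leb Ω) := by
    refine (P.integrable_phaseDeriv u (hc.toLp _)).congr ?_
    filter_upwards [hc.coeFn_toLp] with x hx
    rw [hx]
  -- Testing with `c · 1_E` localizes the inequality, since off `E` both integrands vanish.
  refine ae_le_of_forall_setIntegral_le i1 i2 fun E hE _ => ?_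
  have hz := hc.indicator hE
  have := H (hz.toLp _)
  rw [← integral_indicator hE, ← integral_indicator hE]
  refine le_of_eq_of_le ?_ (this.trans (le_of_eq ?_))
  · refine integral_congr_ae ?_
    filter_upwards [hz.coeFn_toLp] with x hx
    by_cases hxE : x ∈ E <;> simp [hx, hxE]
  · refine integral_congr_ae ?_
    filter_upwards [hz.coeFn_toLp] with x hx
    by_cases hxE : x ∈ E <;> simp [hx, hxE, phaseDeriv_zero]

/-- The residual `w ↦ ∫ (f w - A∇u·∇w)` on `H¹₀(Ω)` is represented by a square integrable function
which is dominated by the phase slope at `u`. -/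
lemma IsMinimizer.exists_representation {u : FunGrad Ω} (hu : P.IsMinimizer u) :
    ∃ h : L2 Ω, (∀ z : L2 Ω, ∫ x, h x * z x ∂(leb Ω) ≤ P.phaseSlope u.1 z) ∧
      ∀ w ∈ H10 Ω, ∫ x, P.f x * w.1 x ∂(leb Ω) - ∫ x, ⟪P.flux u x, w.2 x⟫ ∂(leb Ω)
        = ∫ x, h x * w.1 x ∂(leb Ω) := by
  let ℓ : FunGrad Ω →L[ℝ] ℝ :=
    (innerSL ℝ (P.memLp_f.toLp _)).comp (ContinuousLinearMap.fst ℝ (L2 Ω) (L2Vec Ω))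
      - (innerSL ℝ ((P.memLp_flux u).toLp _)).comp (ContinuousLinearMap.snd ℝ (L2 Ω) (L2Vec Ω))
  have hℓ : ∀ w, ℓ w = ∫ x, P.f x * w.1 x ∂(leb Ω)
      - ∫ x, ⟪P.flux u x, w.2 x⟫ ∂(leb Ω) := fun w => by
    rw [← integral_mul_toLp P.memLp_f, ← integral_inner_toLp (P.memLp_flux u)]
    rfl
  -- The extension is made on the whole product space, with a majorant that ignores the gradient
  -- component.
  obtain ⟨g, hg1, hg2⟩ := exists_extension_of_le_sublinear
    ⟨sobolevZero Ω, ℓ.toLinearMap.domRestrict (sobolevZero Ω)⟩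
    (fun w : FunGrad Ω => P.phaseSlope u.1 w.1)
    (fun c hc w => P.phaseSlope_smul u.1 w.1 hc.le)
    (fun w w' => P.phaseSlope_add_le u.1 w.1 w'.1)
    (fun w => by
      change ℓ w ≤ _
      rw [hℓ]
      exact hu.le_phaseSlope w.2)
  have h0 : P.phaseSlope u.1 0 = 0 := by
    simpa using P.phaseSlope_smul u.1 0 (le_refl (0 : ℝ))
  -- The majorant is `0` at `(0, ±z)`, so the extension depends on the function component alone.
  have hsnd : ∀ z : L2Vec Ω, g (0, z) = 0 := fun z => by
    have h1 : g (0, z) ≤ 0 := (hg2 (0, z)).trans h0.le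
    have h2 : g (0, -z) ≤ 0 := (hg2 (0, -z)).trans h0.le
    have h3 : g (0, -z) = - g (0, z) := by
      rw [← map_neg, Prod.neg_mk, neg_zero]
    linarith
  obtain ⟨C, -, hC⟩ := exists_integral_abs_le (μ := leb Ω)
  have hα := add_pos P.αp_pos P.αm_pos
  have hb : ∀ z : L2 Ω, g (z, 0) ≤ (P.αp + P.αm) * C * ‖z‖ := fun z =>
    ((hg2 (z, 0)).trans (P.phaseSlope_le u.1 z)).trans
      ((mul_le_mul_of_nonneg_left (hC z) hα.le).trans (by rw [mul_assoc]))
  -- By linearity the one-sided bound at `±z` gives continuity, so Riesz applies on `L²(Ω)`.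
  let G : L2 Ω →L[ℝ] ℝ := (g.comp (LinearMap.inl ℝ (L2 Ω) (L2Vec Ω))).mkContinuous
    ((P.αp + P.αm) * C) fun z => by
      change |g (z, 0)| ≤ _
      refine abs_le.2 ⟨?_, hb z⟩
      have h1 := hb (-z)
      have h3 : g (-z, 0) = - g (z, 0) := by
        rw [← map_neg, Prod.neg_mk, neg_zero]
      rw [norm_neg, h3] at h1
      linarith
  let h : L2 Ω := (InnerProductSpace.toDual ℝ (L2 Ω)).symm G
  have hh : ∀ z : L2 Ω, ∫ x, h x * z x ∂(leb Ω) = g (z, 0) := fun z => by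
    have e : ⟪h, z⟫ = g (z, 0) := InnerProductSpace.toDual_symm_apply
    rw [← e, L2.inner_def]
    simp [mul_comm]
  refine ⟨h, fun z => (hh z).trans_le (hg2 (z, 0)), fun w hw => ?_⟩
  have h1 : g w = ℓ w := hg1 ⟨w, hw⟩
  have h2 : w = (w.1, 0) + (0, w.2) := by ext <;> simp
  rw [hh, ← hℓ, ← h1]
  conv_lhs => rw [h2, map_add, hsnd, add_zero]

/-- The flux of the minimizer has a square integrable divergence, which satisfies the
complementarity conditions. -/
lemma IsMinimizer.exists_weakDiv_flux {u : FunGrad Ω} (hu : P.IsMinimizer u) :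
    ∃ r : Euc d → ℝ, P.IsAdmissibleFlux (P.flux u) r ∧ P.IsComplementary u r := by
  obtain ⟨h, h1, h2⟩ := hu.exists_representation
  have hp := P.ae_le_phaseDeriv_of_le_phaseSlope h1 1
  have hm := P.ae_le_phaseDeriv_of_le_phaseSlope h1 (-1)
  have hr : MemLp (fun x => h x - P.f x) 2 (leb Ω) := (Lp.memLp h).sub P.memLp_f
  have hαp := P.αp_pos
  have hαm := P.αm_pos
  refine ⟨fun x => h x - P.f x, ⟨P.memLp_flux u, hr, ?_, ?_⟩, ?_⟩
  · refine isWeakDiv_of_forall_H10 fun w hw => ?_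
    have h3 := h2 w hw
    have h4 : ∫ x, (h x - P.f x) * w.1 x ∂(leb Ω)
        = ∫ x, h x * w.1 x ∂(leb Ω) - ∫ x, P.f x * w.1 x ∂(leb Ω) := by
      rw [← integral_sub ((Lp.memLp h).integrable_mul_fun (Lp.memLp w.1))
        (P.memLp_f.integrable_mul_fun (Lp.memLp w.1))]
      simp only [sub_mul]
    rw [h4]
    linarith
  · filter_upwards [hp, hm] with x e1 e2
    rw [sub_add_cancel]
    -- Directions `±1` bound `h` from both sides: they force `h = α₊` where `u > 0`, `h = -α₋` where
    -- `u < 0`, and `-α₋ ≤ h ≤ α₊` where `u = 0`.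
    unfold phaseDeriv at e1 e2
    split_ifs at e1 e2
    · constructor <;> linarith
    · constructor <;> linarith
    · have i1 : (1 : ℝ)⁺ = 1 := posPart_eq_self.2 zero_le_one
      have i2 : (1 : ℝ)⁻ = 0 := negPart_eq_zero.2 zero_le_one
      rw [posPart_neg, negPart_neg, i1, i2] at e2
      rw [i1, i2] at e1
      constructor <;> linarith
  · filter_upwards [hp, hm] with x e1 e2
    rw [sub_add_cancel]
    refine ⟨fun h0 => ?_, fun h0 => ?_⟩
    · rw [phaseDeriv, if_pos h0] at e1 e2
      linarith
    · rw [phaseDeriv, if_neg h0.not_gt, if_pos h0] at e1 e2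
      linarith

end TwoPhaseProblem

/-! ### The error identities -/

namespace TwoPhaseProblem

variable {d : ℕ} {Ω : Opens (Euc d)} {P : TwoPhaseProblem Ω}

/-- Integration by parts on the affine space `V₀ + u_D`. -/
lemma IsAdmissibleFlux.integral_inner_add {y : Euc d → Euc d} {q : Euc d → ℝ}
    (hy : P.IsAdmissibleFlux y q) {v : FunGrad Ω} (hv : v ∈ P.affineSpace) :
    ∫ x, ⟪y x, v.2 x⟫ ∂(leb Ω) + ∫ x, q x * v.1 x ∂(leb Ω)
      = ∫ x, (⟪y x, P.uD.2 x⟫ + q x * P.uD.1 x) ∂(leb Ω) := by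
  have h := hy.2.2.1.integral_inner_eq hy.1 hy.2.1 (mem_affineSpace.1 hv)
  rw [Prod.fst_sub, Prod.snd_sub, integral_inner_coe_sub hy.1, integral_mul_coe_sub hy.2.1] at h
  rw [integral_add (hy.1.integrable_inner_fun (Lp.memLp _))
    (hy.2.1.integrable_mul_fun (Lp.memLp _))]
  linarith

end TwoPhaseProblem

/-- Error identities for the two-phase obstacle problem: `u` is the exact solution,
`p* = A∇u` its flux (with divergence `r`), `v` and `y` (with divergence `q`) are approximations. -/
theorem theorem3 {d : ℕ} {Ω : Opens (Euc d)} (hΩ : Bornology.IsBounded (Ω : Set (Euc d)))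
    (P : TwoPhaseProblem Ω) (u : FunGrad Ω) (hu : P.IsMinimizer u)
    (v : FunGrad Ω) (hv : v ∈ P.affineSpace)
    (y : Euc d → Euc d) (q : Euc d → ℝ) (hy : P.IsAdmissibleFlux y q) :
    -- the primal and the dual error identity
    P.errPrimal u v = ((P.J v - P.J u : ℝ) : EReal) ∧
    P.errDual u y = P.Istar (P.flux u) - P.Istar y ∧
    -- the identity for the pair
    P.errPair u v y = P.errPrimal u v + P.errDual u y ∧
    P.errPair u v y = ((1 / 2 * weightedNormSq Ω (fun x => (P.A x)⁻¹)
        (fun x => P.flux v x - y x) + P.Upsilon v q : ℝ) : EReal) ∧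
    0 ≤ P.Upsilon v q ∧
    (v = u → y =ᵐ[leb Ω] P.flux u → P.Upsilon v q = 0) ∧
    -- the explicit form of `μ*_ω` and of the (finite) dual energy
    P.muStar u y = ((∫ x in {x | 0 < u.1 x}, (P.αp - (q x + P.f x)) * u.1 x ∂(leb Ω)
      + ∫ x in {x | u.1 x < 0}, (-P.αm - (q x + P.f x)) * u.1 x ∂(leb Ω) : ℝ) : EReal) ∧
    P.Istar y = ((- (1 / 2) * weightedNormSq Ω (fun x => (P.A x)⁻¹) y
      + ∫ x, (⟪y x, P.uD.2 x⟫ + q x * P.uD.1 x) ∂(leb Ω) : ℝ) : EReal) ∧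
    -- the exact flux is admissible and has a finite dual energy; the explicit form of `μ_ω`
    ∃ r : Euc d → ℝ, P.IsAdmissibleFlux (P.flux u) r ∧
      P.Istar (P.flux u) = ((- (1 / 2) * weightedNormSq Ω (fun x => (P.A x)⁻¹) (P.flux u)
        + ∫ x, (⟪P.flux u x, P.uD.2 x⟫ + r x * P.uD.1 x) ∂(leb Ω) : ℝ) : EReal) ∧
      (∀ᵐ x ∂(leb Ω), (0 < u.1 x → r x + P.f x = P.αp) ∧
        (u.1 x < 0 → r x + P.f x = -P.αm)) ∧
      P.mu u v = ((∫ x in {x | 0 < v.1 x}, (P.αp - (r x + P.f x)) * v.1 x ∂(leb Ω)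
        + ∫ x in {x | v.1 x < 0}, (-P.αm - (r x + P.f x)) * v.1 x ∂(leb Ω) : ℝ) : EReal) ∧
      ((∀ᵐ x ∂(leb Ω), u.1 x = 0 → r x + P.f x = 0) →
        P.mu u v = ((∫ x, phaseWeight P.αp P.αm (u.1 x) (v.1 x) * |v.1 x| ∂(leb Ω) : ℝ)
          : EReal)) := by

  have := isFiniteMeasure_leb hΩ
  obtain ⟨r, hp, hc⟩ := hu.exists_weakDiv_flux
  have hua := hu.1
  -- This is the extremality relation `∫ (α₊u₊ + α₋u₋ - f u) = ∫ r u`, needed in the primal and dual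
  -- identities and in the second formula for the pair.
  have hu0 := hc.upsilon_eq_zero
  have hmu : P.mu u v = (P.Upsilon v r : EReal) := P.DF_eq hp hv
  have hmuStar : P.muStar u y = (P.Upsilon u q : EReal) := P.DF_eq hy hua
  have hIy := P.Istar_eq hy
  have hIp := P.Istar_eq hp
  have hu2 := Lp.memLp u.2
  have hv2 := Lp.memLp v.2
  -- the quadratic terms
  have q1 : weightedNormSq Ω P.A (fun x => u.2 x - v.2 x) = weightedNormSq Ω P.A u.2
      - 2 * ∫ x, ⟪P.flux u x, v.2 x⟫ ∂(leb Ω) + weightedNormSq Ω P.A v.2 :=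
    P.weightedNormSq_sub hu2 hv2
  have q2 : weightedNormSq Ω (fun x => (P.A x)⁻¹) (fun x => P.flux u x - y x)
      = weightedNormSq Ω P.A u.2 - 2 * ∫ x, ⟪y x, u.2 x⟫ ∂(leb Ω)
        + weightedNormSq Ω (fun x => (P.A x)⁻¹) y := P.weightedNormSq_inv_sub hu2 hy.1
  have q3 : weightedNormSq Ω (fun x => (P.A x)⁻¹) (fun x => P.flux v x - y x)
      = weightedNormSq Ω P.A v.2 - 2 * ∫ x, ⟪y x, v.2 x⟫ ∂(leb Ω)
        + weightedNormSq Ω (fun x => (P.A x)⁻¹) y := P.weightedNormSq_inv_sub hv2 hy.1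
  have q4 : weightedNormSq Ω (fun x => (P.A x)⁻¹) (fun x => P.flux v x - P.flux u x)
      = weightedNormSq Ω P.A v.2 - 2 * ∫ x, ⟪P.flux u x, v.2 x⟫ ∂(leb Ω)
        + weightedNormSq Ω (fun x => (P.A x)⁻¹) (P.flux u) :=
    P.weightedNormSq_inv_sub hv2 hp.1
  have q5 := P.weightedNormSq_inv_flux u
  have q6 : weightedNormSq Ω P.A u.2 = ∫ x, ⟪P.flux u x, u.2 x⟫ ∂(leb Ω) := rfl
  -- integration by parts
  have g1 := hy.integral_inner_add hv
  have g2 := hy.integral_inner_add hua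
  have g3 := hp.integral_inner_add hv
  have g4 := hp.integral_inner_add hua
  -- the linear terms
  have e1 := P.upsilon_eq v hy.2.1
  have e2 := P.upsilon_eq u hy.2.1
  have e3 := P.upsilon_eq v hp.2.1
  have e4 := P.upsilon_eq u hp.2.1
  -- By `q1`, `q4` and `q5` the last square equals `½‖∇(u - v)‖²_A`, which splits the pair measure
  -- into its primal and dual parts.
  have hpair : P.errPair u v y = ((P.Upsilon u q + P.Upsilon v r
      + 1 / 2 * weightedNormSq Ω (fun x => (P.A x)⁻¹) (fun x => P.flux u x - y x)
      + 1 / 2 * weightedNormSq Ω (fun x => (P.A x)⁻¹) (fun x => P.flux v x - P.flux u x) : ℝ)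
      : EReal) := by
    rw [TwoPhaseProblem.errPair, P.DF_eq hy hua, P.DF_eq hp hv, P.DG_eq hy.1, P.DG_eq hp.1]
    simp only [EReal.coe_add]
  refine ⟨?_, ?_, ?_, ?_, P.upsilon_nonneg v hy.2.2.2, ?_, ?_, hIy, r, hp, hIp, hc, ?_, ?_⟩
  · rw [TwoPhaseProblem.errPrimal, hmu, ← EReal.coe_add, EReal.coe_eq_coe_iff, P.J_eq, P.J_eq]
    linarith
  · rw [TwoPhaseProblem.errDual, hmuStar, hIy, hIp, ← EReal.coe_add, ← EReal.coe_sub,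
      EReal.coe_eq_coe_iff]
    linarith
  · rw [hpair, TwoPhaseProblem.errPrimal, TwoPhaseProblem.errDual, hmu, hmuStar, ← EReal.coe_add,
      ← EReal.coe_add, ← EReal.coe_add, EReal.coe_eq_coe_iff]
    linarith
  · rw [hpair, EReal.coe_eq_coe_iff]
    linarith
  · intro hvu hyp
    have hqr := hy.2.2.1.ae_eq hp.2.2.1 hy.2.1 hp.2.1 hyp
    have h : ∫ x, q x * u.1 x ∂(leb Ω) = ∫ x, r x * u.1 x ∂(leb Ω) :=
      integral_congr_ae (by filter_upwards [hqr] with x hx; rw [hx])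
    rw [hvu]
    linarith
  · rw [hmuStar, P.upsilon_eq_setIntegral u hy.2.1]
  · rw [hmu, P.upsilon_eq_setIntegral v hp.2.1]
  · intro h0
    rw [hmu, hc.upsilon_eq_integral_phaseWeight h0 v]
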